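/- Let $\mathcal H$ be a complex Hilbert space with orthonormal basis $\{e_n\}_{n\ge1}$, and let $\{X_n\}_{n\ge1}$ be i.i.d. nonnegative, (essentially) bounded real random variables on a probability space $(\Omega,\mathcal F,\mathbb P)$. Let $T=T(\omega)$ be the random weighted shift, i.e. the bounded operator with $Te_n=X_ne_{n+1}$ for all $n$ (almost surely well defined). Let $\operatorname{ess\,ran}X_1=\{t\in\mathbb R:\mathbb P(|X_1-t|<\varepsilon)>0\ \ \forall\varepsilon>0\}$, $r=\min\operatorname{ess\,ran}X_1$, $R=\max\operatorname{ess\,ran}X_1$, and assume $R>0$. Write $B(0,s)=\{z\in\mathbb C:|z|<s\}$ and $\overline{B(0,s)}=\{z\in\mathbb C:|z|\le s\}$. For a bounded operator $A$ on $\mathcal H$ let $\sigma(A)$ be its spectrum, $\gamma(A)$ its spectral radius, $\|A\|_e=\inf\{\|A+K\|: K\text{ compact}\}$ its essential norm, $W(A)=\{\langle Ax,x\rangle:\|x\|=1\}$ its numerical range, $w(A)=\sup_{z\in W(A)}|z|$ its numerical radius, and $W_e(A)=\bigcap_{K\text{ compact}}\overline{W(A+K)}$ its essential numerical range. Let $\sigma_p(A)$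 be the set of eigenvalues of $A$, and let $\sigma_\delta(A)$, $\sigma_\pi(A)$, $\sigma_e(A)$, $\sigma_{lre}(A)$ be the sets of $\lambda\in\mathbb C$ for which $A-\lambda$ is, respectively, not surjective, not bounded below, not Fredholm, not semi-Fredholm (semi-Fredholm: closed range, and kernel or cokernel finite-dimensional). For Fredholm $A$, $\operatorname{ind}A=\dim\ker A-\dim(\mathcal H/\operatorname{ran}A)$. Then: 1. Almost surely $\|T\|=\|T\|_e=\gamma(T)=w(T)=R$. 2. Almost surely $\sigma(T)=\sigma_\delta(T)=\overline{B(0,R)}$. 3. Almost surely $\sigma_\pi(T)=\sigma_e(T)=\sigma_{lre}(T)=\{z\in\mathbb C:r\le|z|\le R\}$, and almost surely, for every $\lambda\in B(0,r)$, $T-\lambda$ is Fredholm with $\operatorname{ind}(T-\lambda)=-1$. 4. If $\mathbb P(X_1=0)>0$, then almost surely $\sigma_p(T)=\sigma_p(T^*)=\{0\}$ and $\dim\ker T=\dim\ker T^*=\infty$. 5. If $\mathbb P(X_1=0)=0$, then almost surely $\sigma_p(T)=\emptyset$, $\sigma_p(T^*)=\{0\}\cup B(0,e^{\mathbb E(\ln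 X_1)})$, and $\dim\ker(T^*-\lambda)=1$ for every $\lambda\in\sigma_p(T^*)$. Here $\mathbb E(\ln X_1)\in[-\infty,\infty)$ and $e^{-\infty}=0$. 6. Almost surely $W(T)=B(0,R)$, and almost surely $W_e(T)=\overline{B(0,R)}$. -/

import Mathlib

open MeasureTheory ProbabilityTheory
open scoped ENNReal

noncomputable section

namespace RandomShift

section WeightedShift

variable {H : Type*} [NormedAddCommGroup H] [InnerProductSpace ℂ H]

/-- The coordinates `(0, w₀ x₀, w₁ x₁, …)` of the weighted shift of `x`. -/
def shiftCoord (w : ℕ → ℝ) (x : ℕ → ℂ) : ℕ → ℂ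
  | 0 => 0
  | n + 1 => (w n : ℂ) * x n

theorem norm_shiftCoord_succ_le {w : ℕ → ℝ} {C : ℝ} (hC : ∀ n, |w n| ≤ C) (x : ℕ → ℂ) (n : ℕ) :
    ‖shiftCoord w x (n + 1)‖ ≤ C * ‖x n‖ := by
  simp only [shiftCoord, norm_mul, Complex.norm_real, Real.norm_eq_abs]
  exact mul_le_mul_of_nonneg_right (hC n) (norm_nonneg _)

theorem summable_shiftCoord {w : ℕ → ℝ} {C : ℝ} (hC : ∀ n, |w n| ≤ C)
    (x : lp (fun _ : ℕ => ℂ) 2) : Summable fun n => ‖shiftCoord w x (n + 1)‖ ^ 2 := by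
  have hx : Summable fun n => ‖x n‖ ^ 2 := by
    have h := (memℓp_gen_iff (by norm_num : 0 < (2 : ℝ≥0∞).toReal)).1 (lp.memℓp x)
    simpa using h
  refine Summable.of_nonneg_of_le (fun _ => sq_nonneg _) (fun n => ?_) (hx.mul_left (C ^ 2))
  rw [← mul_pow]
  exact pow_le_pow_left₀ (norm_nonneg _) (norm_shiftCoord_succ_le hC x n) 2

theorem memℓp_shiftCoord {w : ℕ → ℝ} {C : ℝ} (hC : ∀ n, |w n| ≤ C)
    (x : lp (fun _ : ℕ => ℂ) 2) : Memℓp (shiftCoord w x) 2 := by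
  refine memℓp_gen ?_
  simp only [ENNReal.toReal_ofNat, Real.rpow_ofNat]
  exact (summable_nat_add_iff 1).1 (summable_shiftCoord hC x)

/-- The weighted shift on `ℓ²` with bounded weights, as a linear map. -/
def shiftLin (w : ℕ → ℝ) (C : ℝ) (hC : ∀ n, |w n| ≤ C) :
    lp (fun _ : ℕ => ℂ) 2 →ₗ[ℂ] lp (fun _ : ℕ => ℂ) 2 where
  toFun x := ⟨shiftCoord w x, memℓp_shiftCoord hC x⟩
  map_add' x y := by
    ext n
    change shiftCoord w (x + y : lp (fun _ : ℕ => ℂ) 2) n = shiftCoord w x n + shiftCoord w y n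
    cases n with
    | zero => simp [shiftCoord]
    | succ n => simp [shiftCoord, mul_add]
  map_smul' c x := by
    ext n
    change shiftCoord w (c • x : lp (fun _ : ℕ => ℂ) 2) n = c * shiftCoord w x n
    cases n with
    | zero => simp [shiftCoord]
    | succ n => simp [shiftCoord, mul_left_comm]

theorem norm_sq_eq_tsum (y : lp (fun _ : ℕ => ℂ) 2) : ‖y‖ ^ 2 = ∑' n, ‖y n‖ ^ 2 := by
  have h := lp.norm_rpow_eq_tsum (by norm_num : 0 < (2 : ℝ≥0∞).toReal) y
  simpa using h

theorem norm_shiftLin_le (w : ℕ → ℝ) (C : ℝ) (hC : ∀ n, |w n| ≤ C)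
    (x : lp (fun _ : ℕ => ℂ) 2) : ‖shiftLin w C hC x‖ ≤ C * ‖x‖ := by
  have hC0 : 0 ≤ C := (abs_nonneg _).trans (hC 0)
  have hx : Summable fun n => ‖x n‖ ^ 2 := by
    have h := (memℓp_gen_iff (by norm_num : 0 < (2 : ℝ≥0∞).toReal)).1 (lp.memℓp x)
    simpa using h
  have hs := summable_shiftCoord hC x
  have h0 : ‖shiftCoord w x 0‖ ^ 2 = 0 := by simp [shiftCoord]
  have hsum : ∑' n, ‖shiftCoord w x n‖ ^ 2 ≤ ∑' n, C ^ 2 * ‖x n‖ ^ 2 := by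
    have h1 : Summable fun n => ‖shiftCoord w x n‖ ^ 2 :=
      (summable_nat_add_iff (f := fun n => ‖shiftCoord w x n‖ ^ 2) 1).1 hs
    rw [h1.tsum_eq_zero_add, h0, zero_add]
    refine Summable.tsum_le_tsum (fun n => ?_) hs (hx.mul_left (C ^ 2))
    rw [← mul_pow]
    exact pow_le_pow_left₀ (norm_nonneg _) (norm_shiftCoord_succ_le hC x n) 2
  have hsq : ‖shiftLin w C hC x‖ ^ 2 ≤ (C * ‖x‖) ^ 2 := by
    rw [mul_pow, norm_sq_eq_tsum x, ← tsum_mul_left]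
    exact (norm_sq_eq_tsum (shiftLin w C hC x)).trans_le hsum
  exact (sq_le_sq₀ (norm_nonneg _) (mul_nonneg hC0 (norm_nonneg _))).1 hsq

/-- The bounded weighted shift on `ℓ²` with weights bounded by `C`. -/
def shiftL2 (w : ℕ → ℝ) (C : ℝ) (hC : ∀ n, |w n| ≤ C) :
    lp (fun _ : ℕ => ℂ) 2 →L[ℂ] lp (fun _ : ℕ => ℂ) 2 :=
  (shiftLin w C hC).mkContinuous C (norm_shiftLin_le w C hC)

open Classical in
/-- The unilateral weighted shift `e n ↦ w n • e (n + 1)` on a Hilbert space with orthonormal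
basis `e`, as a bounded operator; by convention it is `0` if the weights are unbounded. -/
def weightedShift (e : HilbertBasis ℕ ℂ H) (w : ℕ → ℝ) : H →L[ℂ] H :=
  if h : ∃ C, ∀ n, |w n| ≤ C then
    (e.repr.symm.toContinuousLinearEquiv : lp (fun _ : ℕ => ℂ) 2 →L[ℂ] H) ∘L
      shiftL2 w h.choose h.choose_spec ∘L
      (e.repr.toContinuousLinearEquiv : H →L[ℂ] lp (fun _ : ℕ => ℂ) 2)
  else 0

theorem weightedShift_apply_basis (e : HilbertBasis ℕ ℂ H) {w : ℕ → ℝ}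
    (h : ∃ C, ∀ n, |w n| ≤ C) (n : ℕ) :
    weightedShift e w (e n) = (w n : ℂ) • e (n + 1) := by
  classical
  rw [weightedShift, dif_pos h]
  apply e.repr.injective
  ext k
  simp only [ContinuousLinearMap.comp_apply, map_smul]
  rw [show (e.repr.toContinuousLinearEquiv : H →L[ℂ] lp (fun _ : ℕ => ℂ) 2) (e n)
      = e.repr (e n) from rfl]
  rw [show ∀ y, (e.repr.symm.toContinuousLinearEquiv : lp (fun _ : ℕ => ℂ) 2 →L[ℂ] H) y
      = e.repr.symm y from fun _ => rfl]
  rw [e.repr.apply_symm_apply, e.repr_self, e.repr_self]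
  change shiftCoord w (lp.single 2 n (1 : ℂ) : lp (fun _ : ℕ => ℂ) 2) k
    = (w n : ℂ) * (lp.single 2 (n + 1) (1 : ℂ) : lp (fun _ : ℕ => ℂ) 2) k
  cases k with
  | zero => simp [shiftCoord]
  | succ k =>
    by_cases hk : k = n
    · subst hk; simp [shiftCoord]
    · simp [shiftCoord, hk]

end WeightedShift

section Operators

variable {H : Type*} [NormedAddCommGroup H] [InnerProductSpace ℂ H]

/-- `A - λ`. -/
def shifted (A : H →L[ℂ] H) (z : ℂ) : H →L[ℂ] H := A - z • ContinuousLinearMap.id ℂ H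

/-- The point spectrum `σ_p(A)`: the set of eigenvalues. -/
def pointSpectrum (A : H →L[ℂ] H) : Set ℂ :=
  {z | Module.End.HasEigenvalue (A : H →ₗ[ℂ] H) z}

/-- The approximate point spectrum `σ_π(A)`: `A - z` is not bounded below. -/
def approxPointSpectrum (A : H →L[ℂ] H) : Set ℂ :=
  {z | ¬ ∃ c : ℝ, 0 < c ∧ ∀ x, c * ‖x‖ ≤ ‖shifted A z x‖}

/-- The approximate defect spectrum `σ_δ(A)`: `A - z` is not surjective. -/
def approxDefectSpectrum (A : H →L[ℂ] H) : Set ℂ :=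
  {z | ¬ Function.Surjective (shifted A z)}

/-- Semi-Fredholm: closed range, and finite-dimensional kernel or cokernel. -/
def IsSemiFredholm (A : H →L[ℂ] H) : Prop :=
  IsClosed (A.range : Set H) ∧
    (FiniteDimensional ℂ A.ker ∨ FiniteDimensional ℂ (H ⧸ A.range))

/-- The essential spectrum `σ_e(A)`: `A - z` is not Fredholm. -/
def essSpectrum (A : H →L[ℂ] H) : Set ℂ :=
  {z | ¬ (shifted A z).IsFredholm}

/-- The Wolf spectrum `σ_lre(A)`: `A - z` is not semi-Fredholm. -/
def wolfSpectrum (A : H →L[ℂ] H) : Set ℂ :=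
  {z | ¬ IsSemiFredholm (shifted A z)}

/-- The index `dim ker A - dim coker A` of a Fredholm operator; it is meaningful only together
with `A.IsFredholm`. -/
def index (A : H →L[ℂ] H) : ℤ :=
  (Module.finrank ℂ A.ker : ℤ) - (Module.finrank ℂ (H ⧸ A.range) : ℤ)

/-- The essential norm: the infimum of `‖A + K‖` over compact operators `K`. -/
def essNorm (A : H →L[ℂ] H) : ℝ :=
  sInf {c | ∃ K : H →L[ℂ] H, IsCompactOperator K ∧ c = ‖A + K‖}

/-- The numerical range. -/
def numericalRange (A : H →L[ℂ] H) : Set ℂ :=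
  {z | ∃ x : H, ‖x‖ = 1 ∧ z = inner ℂ x (A x)}

/-- The numerical radius: the supremum of `|z|` over the (bounded) numerical range. -/
def numericalRadius (A : H →L[ℂ] H) : ℝ :=
  sSup {c | ∃ z ∈ numericalRange A, c = ‖z‖}

/-- The essential numerical range: the intersection of the closures of `W(A + K)` over compact
operators `K`. -/
def essNumericalRange (A : H →L[ℂ] H) : Set ℂ :=
  {z | ∀ K : H →L[ℂ] H, IsCompactOperator K → z ∈ closure (numericalRange (A + K))}

end Operators

section Probability

variable {Ω : Type*} [MeasurableSpace Ω]

/-- The essential range of a real random variable. -/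
def essRan (P : Measure Ω) (Y : Ω → ℝ) : Set ℝ :=
  {t | ∀ ε > 0, 0 < P {ω | |Y ω - t| < ε}}

/-- The expectation `E(Y⁺) - E(Y⁻)` in `[-∞, ∞]` (meaningful if one of the two is finite). -/
def expectation (P : Measure Ω) (Y : Ω → ℝ) : EReal :=
  ((∫⁻ ω, ENNReal.ofReal (Y ω) ∂P : ℝ≥0∞) : EReal) -
    ((∫⁻ ω, ENNReal.ofReal (-Y ω) ∂P : ℝ≥0∞) : EReal)

/-- `exp (E (ln Y))` in `[0, ∞]`, where `exp (-∞) = 0`. -/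
def geomMean (P : Measure Ω) (Y : Ω → ℝ) : ℝ≥0∞ :=
  EReal.exp (expectation P fun ω => Real.log (Y ω))

end Probability

end RandomShift

end

noncomputable section

namespace RandomShift

/-! ### Coordinates of a weighted shift and of its adjoint. -/

section AbstractShift

variable {H : Type*} [NormedAddCommGroup H] [InnerProductSpace ℂ H]
  {e : HilbertBasis ℕ ℂ H} {w : ℕ → ℝ} {T : H →L[ℂ] H}

open ContinuousLinearMap (adjoint)

/-! Almost surely all weights lie in `[r, R]` and, by the second Borel–Cantelli lemma, every finite
pattern of positive probability occurs arbitrarily far out (`ae_exists_pattern`). In particular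
there are long runs of weights near `R` followed by long runs near `r` (`HasBlocks`). Also, zero
weights are either absent or recur forever. Apart from the eigenvalues of the adjoint, everything
follows from these facts deterministically.

For `r < ‖z‖ < R`, the solution of the eigenvalue recursion along such a block first grows and then
decays, which gives approximate eigenvectors. On the circles `‖z‖ = r` and `‖z‖ = R`, flat blocks do
this. For `‖z‖ < r` the operator `T - z` is bounded below with one-dimensional cokernel, and for
`‖z‖ > R` it is invertible. Unit vectors on runs near `R` realise every value of `B(0, R)` as `⟨x, T
x⟩`. They can be moved to infinity, hence are insensitive to compact perturbations. Modulus `R` is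
not attained: equality in Cauchy–Schwarz would produce an eigenvector with nonzero eigenvalue.

An eigenvector of the adjoint for `z` has coordinates proportional to `∏ z / X i`, so the question
is for which `t = ‖z‖` the series `∑ ∏ (t / X i) ^ 2` converges. Below `exp (E ln X)` it does, by
the strong law of large numbers. For divergence at and above this value (`ae_sumSqProd_eq_top`), the
sum satisfies `S = 1 + (t / X 0) ^ 2 * S'`, where the tail sum `S'` has the law of `S` and is
independent of `X 0`. Where `S'` is finite, `log S > 2 (log t - log X 0) + log S'`. Since `log S`
and `log S'` have the same law, a positive probability of finiteness would force `E ln X > log t`.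
Truncation makes this rigorous without integrability of `log S`. -/

theorem inner_basis (e : HilbertBasis ℕ ℂ H) (m n : ℕ) :
    inner ℂ (e m) (e n) = if m = n then (1 : ℂ) else 0 :=
  orthonormal_iff_ite.1 e.orthonormal m n

theorem hasSum_norm_sq_repr (e : HilbertBasis ℕ ℂ H) (x : H) :
    HasSum (fun n => ‖e.repr x n‖ ^ 2) (‖x‖ ^ 2) := by
  have h := (memℓp_gen_iff (by norm_num : 0 < (2 : ℝ≥0∞).toReal)).1 (lp.memℓp (e.repr x))
  have h' : Summable fun n => ‖e.repr x n‖ ^ 2 := by simpa using h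
  have := h'.hasSum
  rwa [← norm_sq_eq_tsum, e.repr.norm_map] at this

theorem eq_of_repr_eq {x y : H} (h : ∀ n, e.repr x n = e.repr y n) : x = y :=
  e.repr.injective (by ext n; exact h n)

theorem shifted_apply (A : H →L[ℂ] H) (z : ℂ) (x : H) : shifted A z x = A x - z • x := rfl

section Adjoint

variable [CompleteSpace H]

theorem adjoint_basis_succ (hT : ∀ n, T (e n) = (w n : ℂ) • e (n + 1)) (n : ℕ) :
    adjoint T (e (n + 1)) = (w n : ℂ) • e n := by
  refine eq_of_repr_eq (e := e) fun k => ?_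
  rw [e.repr_apply_apply, e.repr_apply_apply, ContinuousLinearMap.adjoint_inner_right, hT,
    inner_smul_left, inner_smul_right, inner_basis, inner_basis]
  by_cases h : k = n
  · subst h; simp
  · simp [h]

theorem adjoint_basis_zero (hT : ∀ n, T (e n) = (w n : ℂ) • e (n + 1)) :
    adjoint T (e 0) = 0 := by
  refine eq_of_repr_eq (e := e) fun k => ?_
  rw [e.repr_apply_apply, e.repr_apply_apply, ContinuousLinearMap.adjoint_inner_right, hT,
    inner_smul_left, inner_basis]
  simp

theorem repr_shift_succ (hT : ∀ n, T (e n) = (w n : ℂ) • e (n + 1)) (x : H) (n : ℕ) :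
    e.repr (T x) (n + 1) = w n * e.repr x n := by
  rw [e.repr_apply_apply, e.repr_apply_apply, ← ContinuousLinearMap.adjoint_inner_left,
    adjoint_basis_succ hT, inner_smul_left]
  simp

theorem repr_shift_zero (hT : ∀ n, T (e n) = (w n : ℂ) • e (n + 1)) (x : H) :
    e.repr (T x) 0 = 0 := by
  rw [e.repr_apply_apply, ← ContinuousLinearMap.adjoint_inner_left, adjoint_basis_zero hT,
    inner_zero_left]

theorem repr_adjoint_shift (hT : ∀ n, T (e n) = (w n : ℂ) • e (n + 1)) (x : H) (n : ℕ) :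
    e.repr (adjoint T x) n = w n * e.repr x (n + 1) := by
  rw [e.repr_apply_apply, e.repr_apply_apply, ContinuousLinearMap.adjoint_inner_right, hT,
    inner_smul_left]
  simp

theorem hasSum_norm_sq_shift (hT : ∀ n, T (e n) = (w n : ℂ) • e (n + 1)) (x : H) :
    HasSum (fun n => (w n) ^ 2 * ‖e.repr x n‖ ^ 2) (‖T x‖ ^ 2) := by
  have h := (hasSum_nat_add_iff' 1).2 (hasSum_norm_sq_repr e (T x))
  simpa [repr_shift_succ hT, repr_shift_zero hT, mul_pow] using h

theorem norm_shift_le (hT : ∀ n, T (e n) = (w n : ℂ) • e (n + 1)) {R : ℝ} (hR : 0 ≤ R)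
    (hw : ∀ n, |w n| ≤ R) : ‖T‖ ≤ R := by
  refine T.opNorm_le_bound hR fun x => ?_
  rw [← sq_le_sq₀ (norm_nonneg _) (by positivity), mul_pow]
  refine hasSum_le (fun n => ?_) (hasSum_norm_sq_shift hT x)
    ((hasSum_norm_sq_repr e x).mul_left (R ^ 2))
  have : w n ^ 2 ≤ R ^ 2 := sq_le_sq.2 ((hw n).trans (le_abs_self R))
  gcongr

theorem le_norm_shift (hT : ∀ n, T (e n) = (w n : ℂ) • e (n + 1)) {r : ℝ} (hr : 0 ≤ r)
    (hw : ∀ n, r ≤ w n) (x : H) : r * ‖x‖ ≤ ‖T x‖ := by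
  rw [← sq_le_sq₀ (by positivity) (norm_nonneg _), mul_pow]
  refine hasSum_le (fun n => ?_) ((hasSum_norm_sq_repr e x).mul_left (r ^ 2))
    (hasSum_norm_sq_shift hT x)
  have := hw n
  gcongr

/-- The eigenvalue equation of a weighted shift has only the trivial solution if `z ≠ 0`. -/
theorem eq_zero_of_shift_eq_smul (hT : ∀ n, T (e n) = (w n : ℂ) • e (n + 1)) {z : ℂ}
    (hz : z ≠ 0) {x : H} (hx : T x = z • x) : x = 0 := by
  refine eq_of_repr_eq (e := e) fun n => ?_
  have key : ∀ n, z * e.repr x n = e.repr (T x) n := fun n => by rw [hx]; simp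
  induction n with
  | zero =>
    have := key 0
    rw [repr_shift_zero hT] at this
    simpa [hz] using this
  | succ n ih =>
    have := key (n + 1)
    rw [repr_shift_succ hT, ih] at this
    simpa [hz] using this

theorem eq_zero_of_shift_eq_zero (hT : ∀ n, T (e n) = (w n : ℂ) • e (n + 1))
    (hw : ∀ n, w n ≠ 0) {x : H} (hx : T x = 0) : x = 0 := by
  refine eq_of_repr_eq (e := e) fun n => ?_
  have := repr_shift_succ hT x n
  rw [hx] at this
  simpa [hw n] using this

theorem injective_shifted (hT : ∀ n, T (e n) = (w n : ℂ) • e (n + 1)) {z : ℂ}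
    (h : z ≠ 0 ∨ ∀ n, w n ≠ 0) : Function.Injective (shifted T z) := by
  refine (injective_iff_map_eq_zero _).2 fun x hx => ?_
  rw [shifted_apply, sub_eq_zero] at hx
  by_cases hz : z = 0
  · subst hz
    exact eq_zero_of_shift_eq_zero hT (h.resolve_left (by simp)) (by simpa using hx)
  · exact eq_zero_of_shift_eq_smul hT hz hx

theorem adjoint_shifted (A : H →L[ℂ] H) (z : ℂ) :
    adjoint (shifted A z) = shifted (adjoint A) (starRingEnd ℂ z) := by
  rw [shifted, shifted, map_sub, map_smulₛₗ]
  congr 2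
  exact ContinuousLinearMap.adjoint_id

theorem mem_ker_shifted_adjoint_iff (hT : ∀ n, T (e n) = (w n : ℂ) • e (n + 1)) {z : ℂ} {x : H} :
    x ∈ (shifted (adjoint T) z).ker ↔ ∀ n, w n * e.repr x (n + 1) = z * e.repr x n := by
  rw [LinearMap.mem_ker]
  change shifted (adjoint T) z x = 0 ↔ _
  rw [shifted_apply, sub_eq_zero]
  constructor
  · intro h n
    rw [← repr_adjoint_shift hT, h]
    simp
  · intro h
    refine eq_of_repr_eq (e := e) fun n => ?_
    rw [repr_adjoint_shift hT, h]
    simp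

theorem repr_eq_of_mem_ker_shifted_adjoint (hT : ∀ n, T (e n) = (w n : ℂ) • e (n + 1))
    (hw : ∀ n, w n ≠ 0) {z : ℂ} {x : H} (hx : x ∈ (shifted (adjoint T) z).ker) (n : ℕ) :
    e.repr x n = (∏ i ∈ Finset.range n, z / w i) * e.repr x 0 := by
  rw [mem_ker_shifted_adjoint_iff hT] at hx
  induction n with
  | zero => simp
  | succ n ih =>
    have hn : (w n : ℂ) ≠ 0 := Complex.ofReal_ne_zero.2 (hw n)
    rw [Finset.prod_range_succ, mul_right_comm, ← ih, mul_div_assoc', eq_div_iff hn, mul_comm,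
      hx n, mul_comm]

theorem norm_prod_div (hw : ∀ n, 0 ≤ w n) (z : ℂ) (n : ℕ) :
    ‖∏ i ∈ Finset.range n, z / w i‖ = ∏ i ∈ Finset.range n, ‖z‖ / w i := by
  rw [norm_prod]
  refine Finset.prod_congr rfl fun i _ => ?_
  rw [norm_div, Complex.norm_real, Real.norm_of_nonneg (hw i)]

/-- The recursion determines a kernel vector from its coordinate at `0`; only square summability of
the solution is at stake. -/
theorem ker_shifted_adjoint_ne_bot_iff (hT : ∀ n, T (e n) = (w n : ℂ) • e (n + 1))
    (hw : ∀ n, 0 < w n) {z : ℂ} :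
    (shifted (adjoint T) z).ker ≠ ⊥ ↔
      Summable fun n => (∏ i ∈ Finset.range n, ‖z‖ / w i) ^ 2 := by
  have hw' : ∀ n, w n ≠ 0 := fun n => (hw n).ne'
  have hprod := norm_prod_div (fun n => (hw n).le) z
  rw [Submodule.ne_bot_iff]
  constructor
  · rintro ⟨x, hx, hx0⟩
    have hrepr := repr_eq_of_mem_ker_shifted_adjoint hT hw' hx
    have h0 : e.repr x 0 ≠ 0 := fun h => hx0 <| eq_of_repr_eq (e := e) fun n => by
      rw [hrepr n, h]; simp
    have hs := (hasSum_norm_sq_repr e x).summable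
    have : ∀ n, ‖e.repr x n‖ ^ 2 =
        (∏ i ∈ Finset.range n, ‖z‖ / w i) ^ 2 * ‖e.repr x 0‖ ^ 2 := fun n => by
      rw [hrepr n, norm_mul, mul_pow, hprod]
    rw [funext this] at hs
    exact (summable_mul_right_iff (pow_ne_zero 2 (norm_ne_zero_iff.2 h0))).1 hs
  · intro hs
    have hmem : Memℓp (fun n => (∏ i ∈ Finset.range n, z / w i : ℂ)) 2 := by
      refine memℓp_gen ?_
      simpa only [ENNReal.toReal_ofNat, Real.rpow_ofNat, hprod] using hs
    let f : lp (fun _ : ℕ => ℂ) 2 := ⟨_, hmem⟩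
    have hf : ∀ n, f n = ∏ i ∈ Finset.range n, z / w i := fun n => rfl
    refine ⟨e.repr.symm f, ?_, fun h => ?_⟩
    · rw [mem_ker_shifted_adjoint_iff hT]
      intro n
      have hn : (w n : ℂ) ≠ 0 := Complex.ofReal_ne_zero.2 (hw' n)
      rw [e.repr.apply_symm_apply, hf, hf, Finset.prod_range_succ]
      field_simp
    · have := hf 0
      rw [← e.repr.apply_symm_apply f, h] at this
      simp at this

/-- Since the coordinate at `0` determines a kernel vector, pairing with `e 0` embeds the kernel
into `ℂ`. -/
theorem finrank_ker_shifted_adjoint (hT : ∀ n, T (e n) = (w n : ℂ) • e (n + 1))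
    (hw : ∀ n, w n ≠ 0) {z : ℂ} (h : (shifted (adjoint T) z).ker ≠ ⊥) :
    FiniteDimensional ℂ (shifted (adjoint T) z).ker ∧
      Module.finrank ℂ (shifted (adjoint T) z).ker = 1 := by
  let φ : (shifted (adjoint T) z).ker →ₗ[ℂ] ℂ :=
    (innerSL ℂ (e 0) : H →ₗ[ℂ] ℂ) ∘ₗ Submodule.subtype _
  have hφ : Function.Injective φ := by
    refine (injective_iff_map_eq_zero φ).2 fun x hx => ?_
    have hx' : e.repr (x : H) 0 = 0 := by rw [e.repr_apply_apply]; exact hx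
    refine Subtype.ext (eq_of_repr_eq (e := e) fun n => ?_)
    rw [repr_eq_of_mem_ker_shifted_adjoint hT hw x.2, hx']
    simp
  have hfin : FiniteDimensional ℂ (shifted (adjoint T) z).ker := Module.Finite.of_injective φ hφ
  refine ⟨hfin, le_antisymm ?_ ?_⟩
  · simpa using LinearMap.finrank_le_finrank_of_injective hφ
  · have : Nontrivial (shifted (adjoint T) z).ker := Submodule.nontrivial_iff_ne_bot.2 h
    exact Module.finrank_pos

end Adjoint

end AbstractShift

/-! ### Test vectors supported on finite blocks. -/

section BlockVectors

variable {H : Type*} [NormedAddCommGroup H] [InnerProductSpace ℂ H]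
  {e : HilbertBasis ℕ ℂ H} {w : ℕ → ℝ} {T : H →L[ℂ] H}

/-- The vector with the coordinates `a 0, …, a (m - 1)` at the positions `n, …, n + m - 1`. -/
def blockVec (e : HilbertBasis ℕ ℂ H) (a : ℕ → ℂ) (n m : ℕ) : H :=
  ∑ k ∈ Finset.range m, a k • e (n + k)

theorem inner_blockVec_basis (e : HilbertBasis ℕ ℂ H) (a : ℕ → ℂ) (n m j : ℕ) :
    inner ℂ (blockVec e a n m) (e (n + j)) = if j < m then starRingEnd ℂ (a j) else 0 := by
  simp only [blockVec, sum_inner, inner_smul_left, inner_basis]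
  simp

theorem norm_sq_blockVec (e : HilbertBasis ℕ ℂ H) (a : ℕ → ℂ) (n m : ℕ) :
    ‖blockVec e a n m‖ ^ 2 = ∑ k ∈ Finset.range m, ‖a k‖ ^ 2 := by
  have h : (inner ℂ (blockVec e a n m) (blockVec e a n m) : ℂ) =
      ∑ k ∈ Finset.range m, (‖a k‖ : ℂ) ^ 2 := by
    nth_rewrite 2 [blockVec]
    rw [inner_sum]
    refine Finset.sum_congr rfl fun k hk => ?_
    rw [inner_smul_right, inner_blockVec_basis, if_pos (Finset.mem_range.1 hk), Complex.mul_conj']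
  rw [inner_self_eq_norm_sq_to_K] at h
  rw [← Complex.ofReal_inj]
  push_cast
  exact h

/-- Splits the error into an interior part, which a good choice of `a` makes small or zero, and two
boundary vectors, whose size need not grow with the block. -/
theorem shifted_blockVec (hT : ∀ n, T (e n) = (w n : ℂ) • e (n + 1)) (z : ℂ) (a : ℕ → ℂ)
    (n m : ℕ) :
    shifted T z (blockVec e a n m) =
      blockVec e (fun k => w (n + k) * a k - z * a (k + 1)) (n + 1) m +
        z • (a m • e (n + m) - a 0 • e n) := by
  induction m with
  | zero => simp [blockVec]
  | succ m ih =>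
    have h1 : ∀ (b : ℕ → ℂ) n, blockVec e b n (m + 1) = blockVec e b n m + b m • e (n + m) :=
      fun b n => Finset.sum_range_succ _ _
    rw [h1, map_add, ih, h1, map_smul, shifted_apply, hT, show n + 1 + m = n + m + 1 by ring,
      show n + (m + 1) = n + m + 1 by ring]
    module

theorem norm_basis (e : HilbertBasis ℕ ℂ H) (n : ℕ) : ‖e n‖ = 1 := e.orthonormal.1 n

theorem exists_phase (z : ℂ) : ∃ u : ℂ, ‖u‖ = 1 ∧ z = ‖z‖ * u := by
  by_cases hz : z = 0
  · exact ⟨1, by simp, by simp [hz]⟩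
  · have : (‖z‖ : ℂ) ≠ 0 := by simpa using hz
    exact ⟨z / ‖z‖, by simp [hz], by field_simp⟩

/-- Weights which are close to `‖z‖` on long blocks make `z` an approximate eigenvalue. -/
theorem mem_approxPointSpectrum_of_flat (hT : ∀ n, T (e n) = (w n : ℂ) • e (n + 1)) {z : ℂ}
    (hw : ∀ m : ℕ, ∀ ε > 0, ∃ n, ∀ k < m, |w (n + k) - ‖z‖| < ε) :
    z ∈ approxPointSpectrum T := by
  rintro ⟨c, hc, h⟩
  obtain ⟨u, hu, hzu⟩ := exists_phase z
  have huu : u * starRingEnd ℂ u = 1 := by rw [Complex.mul_conj', hu]; simp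
  -- The boundary error `2 * ‖z‖` is then below `c / 2 * √m`; the interior error uses up the other
  -- half of `c * √m`.
  obtain ⟨m, hm⟩ := exists_nat_gt ((4 * ‖z‖ / c) ^ 2)
  obtain ⟨n, hn⟩ := hw m (c / 2) (by positivity)
  -- The rotating phase cancels that of `z`, so that only `w (n + k) - ‖z‖` remains in the interior.
  set a : ℕ → ℂ := fun k => (starRingEnd ℂ u) ^ k with ha
  have hna : ∀ k, ‖a k‖ = 1 := fun k => by simp [ha, hu]
  have hza : ∀ k, z * a (k + 1) = ‖z‖ * a k := fun k => by
    calc z * a (k + 1) = ‖z‖ * u * ((starRingEnd ℂ u) ^ k * starRingEnd ℂ u) := by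
          rw [← hzu]; simp only [ha, pow_succ]
      _ = ‖z‖ * a k * (u * starRingEnd ℂ u) := by simp only [ha]; ring
      _ = ‖z‖ * a k := by rw [huu, mul_one]
  have hx : ‖blockVec e a n m‖ = √m := by
    rw [← Real.sqrt_sq (norm_nonneg (blockVec e a n m)), norm_sq_blockVec]
    simp [hna]
  have h1 : ‖blockVec e (fun k => w (n + k) * a k - z * a (k + 1)) (n + 1) m‖ ≤ c / 2 * √m := by
    rw [← sq_le_sq₀ (norm_nonneg _) (by positivity), norm_sq_blockVec, mul_pow,
      Real.sq_sqrt (by positivity)]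
    calc _ ≤ ∑ k ∈ Finset.range m, (c / 2) ^ 2 := by
          refine Finset.sum_le_sum fun k hk => ?_
          rw [hza, ← sub_mul, norm_mul, hna, mul_one, ← Complex.ofReal_sub, Complex.norm_real]
          exact pow_le_pow_left₀ (norm_nonneg _) (hn k (Finset.mem_range.1 hk)).le 2
      _ = (c / 2) ^ 2 * m := by simp [mul_comm]
  have h2 : ‖z • (a m • e (n + m) - a 0 • e n)‖ ≤ ‖z‖ * 2 := by
    rw [norm_smul]
    gcongr
    refine (norm_sub_le _ _).trans ?_
    simp only [norm_smul, hna, norm_basis]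
    norm_num
  have h3 := h (blockVec e a n m)
  rw [shifted_blockVec hT, hx] at h3
  have h4 := h3.trans ((norm_add_le _ _).trans (add_le_add h1 h2))
  have h5 : 4 * ‖z‖ / c < √m := Real.lt_sqrt_of_sq_lt hm
  rw [div_lt_iff₀ hc] at h5
  linarith

/-- For every `p`, `q`: arbitrarily far out there are `p` weights close to `R`, followed by `q`
weights close to `r`. -/
def HasBlocks (w : ℕ → ℝ) (r R : ℝ) : Prop :=
  ∀ p q N : ℕ, ∀ ε > 0, ∃ n ≥ N, (∀ k < p, |w (n + k) - R| < ε) ∧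
    ∀ k < q, |w (n + p + k) - r| < ε

/-- The coordinates solve the eigenvalue recursion exactly, so only the boundary error remains. They
stay at least `1` while the weights exceed `‖z‖`, then decay to at most `1` on weights below `‖z‖`.
-/
theorem mem_approxPointSpectrum_of_hasBlocks (hT : ∀ n, T (e n) = (w n : ℂ) • e (n + 1))
    {r R : ℝ} (hr : 0 ≤ r) (hw : ∀ n, r ≤ w n ∧ w n ≤ R) (hb : HasBlocks w r R) {z : ℂ}
    (hrz : r < ‖z‖) (hzR : ‖z‖ < R) : z ∈ approxPointSpectrum T := by
  rintro ⟨c, hc, h⟩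
  have hz0 : 0 < ‖z‖ := hr.trans_lt hrz
  have hz : z ≠ 0 := norm_pos_iff.1 hz0
  obtain ⟨p, hp⟩ := exists_nat_gt ((2 * ‖z‖ / c) ^ 2)
  set s := (r + ‖z‖) / 2 with hs
  have hsz : s < ‖z‖ := by linarith
  have hs0 : 0 ≤ s := by positivity
  -- The decay must undo a growth by at most `(R / ‖z‖) ^ p`, so `q` is chosen after `p`.
  obtain ⟨q, hq⟩ : ∃ q : ℕ, (R / ‖z‖) ^ p * (s / ‖z‖) ^ q ≤ 1 := by
    have hlim := (tendsto_pow_atTop_nhds_zero_of_lt_one (div_nonneg hs0 hz0.le)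
      ((div_lt_one hz0).2 hsz)).const_mul ((R / ‖z‖) ^ p)
    rw [mul_zero] at hlim
    exact (hlim.eventually_le_const zero_lt_one).exists
  obtain ⟨n, -, hn1, hn2⟩ := hb p q 0 (min (R - ‖z‖) (s - r))
    (lt_min (by linarith) (by linarith))
  set a : ℕ → ℂ := fun k => ∏ i ∈ Finset.range k, (w (n + i) / z : ℂ) with ha
  have hfac : ∀ i, ‖(w i / z : ℂ)‖ = w i / ‖z‖ := fun i => by
    rw [norm_div, Complex.norm_real, Real.norm_of_nonneg (hr.trans (hw i).1)]
  have hna : ∀ k, ‖a k‖ = ∏ i ∈ Finset.range k, (w (n + i) / ‖z‖) := fun k => by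
    simp only [ha, norm_prod, hfac]
  have hza : ∀ k, w (n + k) * a k - z * a (k + 1) = 0 := fun k => by
    simp only [ha, Finset.prod_range_succ]
    field_simp
    ring
  have hlow : ∀ k ≤ p, 1 ≤ ‖a k‖ := fun k hk => by
    rw [hna]
    rw [← Finset.prod_const_one (s := Finset.range k)]
    refine Finset.prod_le_prod (fun _ _ => zero_le_one) fun i hi => ?_
    rw [one_le_div hz0]
    have := abs_lt.1 (hn1 i ((Finset.mem_range.1 hi).trans_le hk))
    have := min_le_left (R - ‖z‖) (s - r)
    linarith
  have hup : ‖a (p + q)‖ ≤ 1 := by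
    rw [hna, Finset.prod_range_add]
    refine le_trans (mul_le_mul ?_ ?_ ?_ ?_) hq
    · refine (Finset.prod_le_prod (g := fun _ => R / ‖z‖)
        (fun i _ => div_nonneg (hr.trans (hw _).1) hz0.le) fun i _ => ?_).trans
        (by rw [Finset.prod_const, Finset.card_range])
      have := (hw (n + i)).2
      gcongr
    · refine (Finset.prod_le_prod (g := fun _ => s / ‖z‖)
        (fun i _ => div_nonneg (hr.trans (hw _).1) hz0.le) fun i hi => ?_).trans
        (by rw [Finset.prod_const, Finset.card_range])
      have := abs_lt.1 (hn2 i (Finset.mem_range.1 hi))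
      have := min_le_right (R - ‖z‖) (s - r)
      rw [← add_assoc]
      gcongr
      linarith
    · exact Finset.prod_nonneg fun i _ => div_nonneg (hr.trans (hw _).1) hz0.le
    · have : 0 ≤ R := hz0.le.trans hzR.le
      positivity
  have hx : √p ≤ ‖blockVec e a n (p + q)‖ := by
    rw [← Real.sqrt_sq (norm_nonneg (blockVec e a n _)), norm_sq_blockVec]
    refine Real.sqrt_le_sqrt ?_
    rw [Finset.sum_range_add]
    refine le_add_of_le_of_nonneg ?_ (Finset.sum_nonneg fun _ _ => by positivity)
    calc (p : ℝ) = ∑ k ∈ Finset.range p, (1 : ℝ) := by simp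
      _ ≤ _ := Finset.sum_le_sum fun k hk => one_le_pow₀ (hlow k (Finset.mem_range.1 hk).le)
  have h2 : ‖z • (a (p + q) • e (n + (p + q)) - a 0 • e n)‖ ≤ ‖z‖ * 2 := by
    rw [norm_smul]
    gcongr
    refine (norm_sub_le _ _).trans ?_
    have : ‖a 0‖ = 1 := by simp [ha]
    simp only [norm_smul, norm_basis, this]
    linarith
  have h3 := h (blockVec e a n (p + q))
  have h1 : blockVec e (fun k => w (n + k) * a k - z * a (k + 1)) (n + 1) (p + q) = 0 := by
    simp [blockVec, hza]
  rw [shifted_blockVec hT, h1, zero_add] at h3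
  have h4 := (mul_le_mul_of_nonneg_left hx hc.le).trans (h3.trans h2)
  have h5 : 2 * ‖z‖ / c < √p := Real.lt_sqrt_of_sq_lt hp
  rw [div_lt_iff₀ hc] at h5
  linarith

/-- Every `z` with `‖z‖ < R` is a value of the quadratic form of `T` on a unit vector which is
supported far out. -/
theorem exists_unit_inner_eq (hT : ∀ n, T (e n) = (w n : ℂ) • e (n + 1)) {r R : ℝ}
    (hb : HasBlocks w r R) {z : ℂ} (hz : ‖z‖ < R) (N : ℕ) :
    ∃ x : H, ‖x‖ = 1 ∧ inner ℂ x (T x) = z ∧ ∀ k < N, inner ℂ (e k) x = 0 := by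
  obtain ⟨u, hu, hzu⟩ := exists_phase z
  have huu : starRingEnd ℂ u * u = 1 := by rw [Complex.conj_mul', hu]; simp
  have hgap : 0 < R - ‖z‖ := by linarith
  -- The vector `y` below has `m + 1` coordinates but only `m` weights enter `⟨y, T y⟩`; this `m`
  -- makes up for the loss and gives `hSm`.
  obtain ⟨m, hm⟩ := exists_nat_gt (2 * ‖z‖ / (R - ‖z‖))
  have hm0 : (0 : ℝ) < m := lt_of_le_of_lt (by positivity) hm
  rw [div_lt_iff₀ hgap] at hm
  obtain ⟨n, hnN, hn, -⟩ := hb m 0 N ((R - ‖z‖) / 2) (by positivity)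
  set S := ∑ k ∈ Finset.range m, w (n + k) with hS
  have hSlow : m * ((R + ‖z‖) / 2) ≤ S := by
    calc m * ((R + ‖z‖) / 2) = ∑ k ∈ Finset.range m, (R + ‖z‖) / 2 := by simp
      _ ≤ S := Finset.sum_le_sum fun k hk => by
          have := abs_lt.1 (hn k (Finset.mem_range.1 hk))
          linarith
  have hSm : (m + 1) * ‖z‖ ≤ S := by linarith
  have hS0 : 0 < S := by
    have : 0 < R + ‖z‖ := by linarith [norm_nonneg z]
    exact (by positivity : 0 < m * ((R + ‖z‖) / 2)).trans_le hSlow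
  set a : ℕ → ℂ := fun k => (starRingEnd ℂ u) ^ k with ha
  have hna : ∀ k, ‖a k‖ = 1 := fun k => by simp [ha, hu]
  set y := blockVec e a n (m + 1) with hy
  -- Two places beyond the support of `y`, so that `f` is orthogonal to `y` and to `T y`, and `T f`
  -- to `y`.
  set f := e (n + (m + 2)) with hf
  have hny : ‖y‖ ^ 2 = m + 1 := by rw [hy, norm_sq_blockVec]; simp [hna]
  have hTy : T y = ∑ k ∈ Finset.range (m + 1), ((w (n + k) * a k : ℂ)) • e (n + (k + 1)) := by
    simp only [hy, blockVec, map_sum, map_smul, hT, smul_smul, mul_comm, add_assoc]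
  have hyTy : inner ℂ y (T y) = S * u := by
    rw [hTy, inner_sum, Finset.sum_range_succ]
    simp only [inner_smul_right, hy, inner_blockVec_basis]
    rw [if_neg (by simp), mul_zero, add_zero, hS, Complex.ofReal_sum, Finset.sum_mul]
    refine Finset.sum_congr rfl fun k hk => ?_
    rw [if_pos (by simpa using hk)]
    simp only [ha, map_pow, Complex.conj_conj]
    rw [pow_succ, mul_assoc, ← mul_assoc (_ ^ k), ← mul_pow, huu, one_pow, one_mul]
  have hyf : inner ℂ y f = 0 := by simp [hy, hf, inner_blockVec_basis]
  have hyTf : inner ℂ y (T f) = 0 := by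
    rw [hf, hT, inner_smul_right, add_assoc, hy, inner_blockVec_basis]; simp
  have hfTy : inner ℂ f (T y) = 0 := by
    rw [hTy, inner_sum]
    refine Finset.sum_eq_zero fun k hk => ?_
    have := Finset.mem_range.1 hk
    rw [inner_smul_right, hf, inner_basis, if_neg (by omega), mul_zero]
  have hfTf : inner ℂ f (T f) = 0 := by
    rw [hf, hT, inner_smul_right, inner_basis, if_neg (by omega), mul_zero]
  have hnf : ‖f‖ = 1 := norm_basis e _
  have h1 : ‖z‖ / S * (m + 1) ≤ 1 := by rw [div_mul_eq_mul_div, div_le_one hS0]; linarith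
  -- `β` scales the value `S * u` down to `z`; `γ` fills up the norm to `1` without changing the
  -- value.
  set β : ℝ := √(‖z‖ / S)
  set γ : ℝ := √(1 - ‖z‖ / S * (m + 1))
  have hβ : β ^ 2 = ‖z‖ / S := Real.sq_sqrt (by positivity)
  have hγ : γ ^ 2 = 1 - ‖z‖ / S * (m + 1) := Real.sq_sqrt (by linarith)
  refine ⟨(β : ℂ) • y + (γ : ℂ) • f, ?_, ?_, fun k hk => ?_⟩
  · have : ‖(β : ℂ) • y + (γ : ℂ) • f‖ ^ 2 = 1 := by
      rw [sq, norm_add_sq_eq_norm_sq_add_norm_sq_of_inner_eq_zero (𝕜 := ℂ) _ _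
        (by rw [inner_smul_left, inner_smul_right, hyf, mul_zero, mul_zero]), ← sq, ← sq, norm_smul, norm_smul,
        mul_pow, mul_pow, hny, hnf, Complex.norm_real, Complex.norm_real, Real.norm_eq_abs,
        Real.norm_eq_abs, sq_abs, sq_abs, hβ, hγ]
      ring
    exact (pow_eq_one_iff_of_nonneg (norm_nonneg _) two_ne_zero).1 this
  · have hβ' : (β : ℂ) * β = ‖z‖ / S := by rw [← sq]; exact_mod_cast hβ
    have hS' : (S : ℂ) ≠ 0 := by exact_mod_cast hS0.ne'
    simp only [map_add, map_smul, inner_add_left, inner_add_right, inner_smul_left,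
      inner_smul_right, hyTy, hyTf, hfTy, hfTf, Complex.conj_ofReal, mul_zero, add_zero]
    rw [← mul_assoc, hβ', ← mul_assoc, div_mul_cancel₀ _ hS', ← hzu]
  · rw [inner_add_right, inner_smul_right, inner_smul_right, hf, inner_basis, if_neg (by omega),
      hy, blockVec, inner_sum, Finset.sum_eq_zero]
    · simp
    · intro i _
      rw [inner_smul_right, inner_basis, if_neg (by omega), mul_zero]

end BlockVectors

/-! ### Eigenvalues, operators bounded below, and inclusions between spectra. -/

section BoundedBelow

variable {H : Type*} [NormedAddCommGroup H] [InnerProductSpace ℂ H]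

theorem mem_pointSpectrum_iff {A : H →L[ℂ] H} {z : ℂ} :
    z ∈ pointSpectrum A ↔ ∃ x ≠ 0, A x = z • x := by
  constructor
  · intro h
    obtain ⟨x, hx⟩ := Module.End.HasEigenvalue.exists_hasEigenvector h
    exact ⟨x, hx.2, hx.apply_eq_smul⟩
  · rintro ⟨x, hx0, hx⟩
    exact Module.End.hasEigenvalue_of_hasEigenvector
      ⟨Module.End.mem_eigenspace_iff.2 hx, hx0⟩

theorem mem_pointSpectrum_iff_ker_ne_bot {A : H →L[ℂ] H} {z : ℂ} :
    z ∈ pointSpectrum A ↔ (shifted A z).ker ≠ ⊥ := by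
  rw [mem_pointSpectrum_iff, Submodule.ne_bot_iff]
  refine exists_congr fun x => ?_
  rw [and_comm, LinearMap.mem_ker]
  exact and_congr_left fun _ => sub_eq_zero.symm

theorem antilipschitz_of_le_norm {A : H →L[ℂ] H} {c : ℝ} (hc : 0 < c)
    (h : ∀ x, c * ‖x‖ ≤ ‖A x‖) : AntilipschitzWith (Real.toNNReal c⁻¹) A := by
  refine A.antilipschitz_of_bound fun x => ?_
  rw [Real.coe_toNNReal _ (by positivity), inv_mul_eq_div, le_div_iff₀' hc]
  exact h x

theorem ker_eq_bot_of_le_norm {A : H →L[ℂ] H} {c : ℝ} (hc : 0 < c)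
    (h : ∀ x, c * ‖x‖ ≤ ‖A x‖) : A.ker = ⊥ :=
  LinearMap.ker_eq_bot.2 (antilipschitz_of_le_norm hc h).injective

theorem isClosed_range_of_le_norm [CompleteSpace H] {A : H →L[ℂ] H} {c : ℝ} (hc : 0 < c)
    (h : ∀ x, c * ‖x‖ ≤ ‖A x‖) : IsClosed (A.range : Set H) :=
  (antilipschitz_of_le_norm hc h).isClosed_range A.uniformContinuous

theorem isFredholm_of_le_norm [CompleteSpace H] {A : H →L[ℂ] H} {c : ℝ} (hc : 0 < c)
    (h : ∀ x, c * ‖x‖ ≤ ‖A x‖) (hfin : FiniteDimensional ℂ (H ⧸ A.range)) : A.IsFredholm where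
  isStrictMap := ((antilipschitz_of_le_norm hc h).isClosedEmbedding
    A.uniformContinuous).isClosedMap.isStrictMap A.continuous
  isClosed_range := isClosed_range_of_le_norm hc h
  finite_ker := by rw [ker_eq_bot_of_le_norm hc h]; infer_instance
  finite_coker := hfin
  closedComplemented_ker := by
    rw [ker_eq_bot_of_le_norm hc h]
    exact Submodule.closedComplemented_bot

theorem _root_.ContinuousLinearMap.IsFredholm.isSemiFredholm {A : H →L[ℂ] H}
    (h : A.IsFredholm) : IsSemiFredholm A :=
  ⟨h.isClosed_range, Or.inl h.finite_ker⟩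

theorem wolfSpectrum_subset_essSpectrum (A : H →L[ℂ] H) : wolfSpectrum A ⊆ essSpectrum A :=
  fun _ hz h => hz h.isSemiFredholm

theorem wolfSpectrum_subset_approxDefectSpectrum (A : H →L[ℂ] H) :
    wolfSpectrum A ⊆ approxDefectSpectrum A := by
  intro z hz hs
  have hr : (shifted A z).range = ⊤ := LinearMap.range_eq_top.2 hs
  refine hz ⟨?_, Or.inr ?_⟩
  · rw [hr]; exact isClosed_univ
  · rw [hr]; infer_instance

/-- The cokernel of an operator with closed range is the kernel of the adjoint. -/
def quotientRangeEquiv [CompleteSpace H] (A : H →L[ℂ] H) (hA : IsClosed (A.range : Set H)) :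
    (H ⧸ A.range) ≃ₗ[ℂ] (ContinuousLinearMap.adjoint A).ker :=
  haveI : CompleteSpace A.range := hA.completeSpace_coe
  (Submodule.quotientEquivOfIsCompl _ _
    (Submodule.isCompl_orthogonal _)).trans
    (LinearEquiv.ofEq _ _ A.orthogonal_range)

theorem shifted_eq_neg (A : H →L[ℂ] H) (z : ℂ) :
    shifted A z = -(algebraMap ℂ (H →L[ℂ] H) z - A) := by
  rw [neg_sub]; rfl

theorem isUnit_shifted_of_notMem_spectrum {A : H →L[ℂ] H} {z : ℂ} (hz : z ∉ spectrum ℂ A) :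
    IsUnit (shifted A z) := by
  rw [shifted_eq_neg, IsUnit.neg_iff]
  exact spectrum.notMem_iff.1 hz

theorem surjective_shifted_of_notMem_spectrum {A : H →L[ℂ] H} {z : ℂ} (hz : z ∉ spectrum ℂ A) :
    Function.Surjective (shifted A z) := by
  obtain ⟨⟨u, v, huv, hvu⟩, rfl⟩ := isUnit_shifted_of_notMem_spectrum hz
  exact fun y => ⟨v y, congrArg (fun f : H →L[ℂ] H => f y) huv⟩

theorem approxDefectSpectrum_subset_spectrum (A : H →L[ℂ] H) :
    approxDefectSpectrum A ⊆ spectrum ℂ A :=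
  fun _ hz => by_contra fun h => hz (surjective_shifted_of_notMem_spectrum h)

theorem le_norm_shifted_of_norm_lt (A : H →L[ℂ] H) (z : ℂ) (x : H) :
    (‖z‖ - ‖A‖) * ‖x‖ ≤ ‖shifted A z x‖ := by
  have h1 := norm_sub_norm_le (z • x) (A x)
  rw [norm_sub_rev, norm_smul] at h1
  have h2 := A.le_opNorm x
  rw [shifted_apply]
  linarith

theorem isFredholm_shifted_of_norm_lt [CompleteSpace H] [Nontrivial H] {A : H →L[ℂ] H} {z : ℂ}
    (hz : ‖A‖ < ‖z‖) : (shifted A z).IsFredholm := by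
  refine isFredholm_of_le_norm (sub_pos.2 hz) (le_norm_shifted_of_norm_lt A z) ?_
  have hs : z ∉ spectrum ℂ A := fun h =>
    hz.not_ge (by simpa using spectrum.subset_closedBall_norm A h)
  rw [LinearMap.range_eq_top.2 (surjective_shifted_of_notMem_spectrum hs)]
  infer_instance

end BoundedBelow

/-! ### Spectral radius, weakly null sequences, numerical radius. -/

section Hilbert

variable {H : Type*} [NormedAddCommGroup H] [InnerProductSpace ℂ H]
  {e : HilbertBasis ℕ ℂ H} {R : ℝ}

open Filter Topology

theorem nontrivial_of_hilbertBasis (e : HilbertBasis ℕ ℂ H) : Nontrivial H :=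
  ⟨e 0, 0, e.orthonormal.ne_zero 0⟩

theorem not_finiteDimensional_of_basis_mem {p : Submodule ℂ H} {f : ℕ → ℕ}
    (hf : Function.Injective f) (h : ∀ n, e (f n) ∈ p) : ¬ FiniteDimensional ℂ p := by
  intro hfin
  have hli : LinearIndependent ℂ fun n => (⟨e (f n), h n⟩ : p) :=
    LinearIndependent.of_comp p.subtype (e.orthonormal.linearIndependent.comp f hf)
  exact not_finite_iff_infinite.2 (inferInstance : Infinite ℕ) hli.finite

theorem spectralRadius_eq_of_spectrum_eq {A : H →L[ℂ] H} (hR : 0 ≤ R)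
    (h : spectrum ℂ A = Metric.closedBall 0 R) : spectralRadius ℂ A = ENNReal.ofReal R := by
  rw [spectralRadius, h]
  refine le_antisymm (iSup₂_le fun z hz => ?_) ?_
  · rw [mem_closedBall_zero_iff] at hz
    rw [← enorm_eq_nnnorm, ← ofReal_norm]
    exact ENNReal.ofReal_le_ofReal hz
  · refine le_trans (le_of_eq ?_) (le_iSup₂ (f := fun (z : ℂ) _ => (‖z‖₊ : ℝ≥0∞)) (R : ℂ)
      (by simp [abs_of_nonneg hR]))
    rw [← enorm_eq_nnnorm, ← ofReal_norm, Complex.norm_real, Real.norm_of_nonneg hR]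

/-- Unit vectors escaping to infinity are weakly null: they become orthogonal to each partial sum of
the expansion of `v`. -/
theorem tendsto_inner_of_support {x : ℕ → H} (hx : ∀ n, ‖x n‖ = 1)
    (hsupp : ∀ n, ∀ k < n, inner ℂ (e k) (x n) = 0) (v : H) :
    Tendsto (fun n => (inner ℂ v (x n) : ℂ)) atTop (𝓝 0) := by
  rw [Metric.tendsto_atTop]
  intro ε hε
  obtain ⟨N, hN⟩ := (Metric.tendsto_atTop.1 (e.hasSum_repr v).tendsto_sum_nat) ε hε
  refine ⟨N, fun n hn => ?_⟩
  set s := ∑ k ∈ Finset.range N, e.repr v k • e k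
  have hs : inner ℂ s (x n) = 0 := by
    rw [sum_inner]
    refine Finset.sum_eq_zero fun k hk => ?_
    rw [inner_smul_left, hsupp n k ((Finset.mem_range.1 hk).trans_le hn), mul_zero]
  have h1 : inner ℂ v (x n) = inner ℂ (v - s) (x n) := by rw [inner_sub_left, hs, sub_zero]
  rw [dist_zero_right, h1]
  calc ‖inner ℂ (v - s) (x n)‖ ≤ ‖v - s‖ * ‖x n‖ := norm_inner_le_norm _ _
    _ = dist s v := by rw [hx, mul_one, dist_eq_norm, norm_sub_rev]
    _ < ε := hN N le_rfl

theorem numericalRange_subset_closedBall (A : H →L[ℂ] H) :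
    numericalRange A ⊆ Metric.closedBall 0 ‖A‖ := by
  rintro _ ⟨x, hx, rfl⟩
  rw [mem_closedBall_zero_iff]
  refine (norm_inner_le_norm _ _).trans ?_
  simpa [hx] using A.le_opNorm x

theorem numericalRadius_eq_of_numericalRange_eq {A : H →L[ℂ] H} (hR : 0 < R)
    (h : numericalRange A = Metric.ball 0 R) : numericalRadius A = R := by
  rw [numericalRadius, h]
  refine csSup_eq_of_forall_le_of_forall_lt_exists_gt ⟨0, 0, by simpa using hR, by simp⟩ ?_ ?_
  · rintro _ ⟨z, hz, rfl⟩
    exact (mem_ball_zero_iff.1 hz).le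
  · intro c hc
    -- The maximum with `0` ensures `‖b‖ = b`.
    obtain ⟨b, hb, hbR⟩ := exists_between (max_lt hc hR)
    have hb0 : 0 ≤ b := (le_max_right _ _).trans hb.le
    have hnorm : ‖(b : ℂ)‖ = b := by rw [Complex.norm_real, Real.norm_of_nonneg hb0]
    exact ⟨b, ⟨b, by rwa [mem_ball_zero_iff, hnorm], hnorm.symm⟩, (le_max_left _ _).trans_lt hb⟩

end Hilbert

/-! ### Spectra and numerical ranges for deterministic weights with blocks. -/

section Spectra

variable {H : Type*} [NormedAddCommGroup H] [InnerProductSpace ℂ H] [CompleteSpace H]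
  {e : HilbertBasis ℕ ℂ H} {w : ℕ → ℝ} {T : H →L[ℂ] H} {r R : ℝ}

open ContinuousLinearMap (adjoint)
open Filter Topology

/-- A zero weight at `n` puts `e n` into the kernel of `T` and `e (n + 1)` into that of the adjoint.
-/
theorem not_finiteDimensional_ker (hT : ∀ n, T (e n) = (w n : ℂ) • e (n + 1))
    (hw : ∀ N, ∃ n ≥ N, w n = 0) :
    ¬ FiniteDimensional ℂ T.ker ∧ ¬ FiniteDimensional ℂ (adjoint T).ker := by
  have hinf : {n | w n = 0}.Infinite := Set.infinite_of_forall_exists_gt fun N => by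
    obtain ⟨n, hn, h⟩ := hw (N + 1)
    exact ⟨n, h, hn⟩
  let f := hinf.natEmbedding
  have hf : ∀ n, w (f n) = 0 := fun n => (f n).2
  have hfi : Function.Injective fun n => (f n : ℕ) := Subtype.val_injective.comp f.injective
  refine ⟨not_finiteDimensional_of_basis_mem (e := e) hfi fun n => ?_,
    not_finiteDimensional_of_basis_mem (e := e) (f := fun n => (f n : ℕ) + 1)
      (fun a b h => hfi (Nat.succ_injective h)) fun n => ?_⟩
  · change T (e _) = 0
    rw [hT, hf]; simp
  · change adjoint T (e _) = 0
    rw [adjoint_basis_succ hT, hf]; simp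

theorem pointSpectrum_of_frequently_zero (hT : ∀ n, T (e n) = (w n : ℂ) • e (n + 1))
    (hw : ∀ N, ∃ n ≥ N, w n = 0) : pointSpectrum T = {0} := by
  ext z
  rw [mem_pointSpectrum_iff, Set.mem_singleton_iff]
  constructor
  · rintro ⟨x, hx0, hx⟩
    by_contra hz
    exact hx0 (eq_zero_of_shift_eq_smul hT hz hx)
  · rintro rfl
    obtain ⟨n, -, hn⟩ := hw 0
    exact ⟨e n, e.orthonormal.ne_zero n, by rw [hT, hn]; simp⟩

/-- If `z ≠ 0`, a zero weight at `m` forces the coordinate at `m` to vanish, and the recursion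
carries this down to all smaller indices. -/
theorem pointSpectrum_adjoint_of_frequently_zero
    (hT : ∀ n, T (e n) = (w n : ℂ) • e (n + 1)) (hw : ∀ N, ∃ n ≥ N, w n = 0) :
    pointSpectrum (adjoint T) = {0} := by
  ext z
  rw [mem_pointSpectrum_iff, Set.mem_singleton_iff]
  constructor
  · rintro ⟨x, hx0, hx⟩
    by_contra hz
    have hrec : ∀ n, w n * e.repr x (n + 1) = z * e.repr x n :=
      mem_ker_shifted_adjoint_iff hT |>.1 (sub_eq_zero.2 hx)
    refine hx0 (eq_of_repr_eq (e := e) fun n => ?_)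
    obtain ⟨m, hm, hwm⟩ := hw n
    have hxm : e.repr x m = 0 := by
      have := hrec m
      rw [hwm] at this
      simpa [hz] using this
    have : e.repr x n = 0 := by
      refine Nat.decreasingInduction (motive := fun k _ => e.repr x k = 0) (fun k _ hk => ?_)
        hxm hm
      have := hrec k
      rw [hk] at this
      simpa [hz] using this
    simpa using this
  · rintro rfl
    exact ⟨e 0, e.orthonormal.ne_zero 0, by rw [adjoint_basis_zero hT]; simp⟩

theorem pointSpectrum_of_ne_zero (hT : ∀ n, T (e n) = (w n : ℂ) • e (n + 1)) (hw : ∀ n, w n ≠ 0) :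
    pointSpectrum T = ∅ := by
  refine Set.eq_empty_of_forall_notMem fun z hz => ?_
  rw [mem_pointSpectrum_iff] at hz
  obtain ⟨x, hx0, hx⟩ := hz
  exact hx0 (injective_shifted hT (Or.inr hw) (by rw [map_zero, shifted_apply, hx, sub_self]))

theorem le_norm_shifted_of_le (hT : ∀ n, T (e n) = (w n : ℂ) • e (n + 1)) (hr : 0 ≤ r)
    (hw : ∀ n, r ≤ w n) (z : ℂ) (x : H) : (r - ‖z‖) * ‖x‖ ≤ ‖shifted T z x‖ := by
  have h1 := norm_sub_norm_le (T x) (z • x)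
  rw [norm_smul] at h1
  have h2 := le_norm_shift hT hr hw x
  rw [shifted_apply]
  linarith

/-- In the inner disc `T - z` is Fredholm of index `-1`. -/
theorem isFredholm_shifted_of_lt (hT : ∀ n, T (e n) = (w n : ℂ) • e (n + 1))
    (hw : ∀ n, r ≤ w n) {z : ℂ} (hz : ‖z‖ < r) :
    (shifted T z).IsFredholm ∧ index (shifted T z) = -1 := by
  have hr : 0 < r := (norm_nonneg z).trans_lt hz
  have hw0 : ∀ n, 0 < w n := fun n => hr.trans_le (hw n)
  have hbelow := le_norm_shifted_of_le hT hr.le hw z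
  have hclosed := isClosed_range_of_le_norm (sub_pos.2 hz) hbelow
  -- The products are dominated by the powers of `‖z‖ / r < 1`.
  have hker : (shifted (adjoint T) (starRingEnd ℂ z)).ker ≠ ⊥ := by
    rw [ker_shifted_adjoint_ne_bot_iff hT hw0, RCLike.norm_conj]
    refine Summable.of_nonneg_of_le (fun n => sq_nonneg _) (fun n => ?_)
      (summable_geometric_of_lt_one (r := (‖z‖ / r) ^ 2) (by positivity)
        (pow_lt_one₀ (by positivity) ((div_lt_one hr).2 hz) two_ne_zero))
    rw [← pow_mul, mul_comm, pow_mul]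
    have h0 : ∀ i, 0 ≤ ‖z‖ / w i := fun i => div_nonneg (norm_nonneg _) (hw0 i).le
    refine pow_le_pow_left₀ (Finset.prod_nonneg fun i _ => h0 i) ?_ 2
    refine (Finset.prod_le_prod (g := fun _ => ‖z‖ / r) (fun i _ => h0 i) fun i _ => ?_).trans
      (by rw [Finset.prod_const, Finset.card_range])
    have := hw i
    gcongr
  obtain ⟨hfin, hrank⟩ := finrank_ker_shifted_adjoint hT (fun n => (hw0 n).ne') hker
  rw [← adjoint_shifted] at hfin hrank
  let E := quotientRangeEquiv _ hclosed
  refine ⟨isFredholm_of_le_norm (sub_pos.2 hz) hbelow E.symm.finiteDimensional, ?_⟩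
  rw [index, E.finrank_eq, hrank, ker_eq_bot_of_le_norm (sub_pos.2 hz) hbelow]
  simp

theorem shift_norm_le (hT : ∀ n, T (e n) = (w n : ℂ) • e (n + 1)) (hr : 0 ≤ r)
    (hw : ∀ n, r ≤ w n ∧ w n ≤ R) : ‖T‖ ≤ R :=
  norm_shift_le hT (hr.trans ((hw 0).1.trans (hw 0).2)) fun n => by
    rw [abs_of_nonneg (hr.trans (hw n).1)]; exact (hw n).2

theorem essSpectrum_subset (hT : ∀ n, T (e n) = (w n : ℂ) • e (n + 1)) (hr : 0 ≤ r)
    (hw : ∀ n, r ≤ w n ∧ w n ≤ R) : essSpectrum T ⊆ {z : ℂ | r ≤ ‖z‖ ∧ ‖z‖ ≤ R} := by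
  intro z hz
  have := nontrivial_of_hilbertBasis e
  constructor
  · by_contra! h
    exact hz (isFredholm_shifted_of_lt hT (fun n => (hw n).1) h).1
  · by_contra! h
    exact hz (isFredholm_shifted_of_norm_lt ((shift_norm_le hT hr hw).trans_lt h))

theorem approxPointSpectrum_shift (hT : ∀ n, T (e n) = (w n : ℂ) • e (n + 1)) (hr : 0 ≤ r)
    (hw : ∀ n, r ≤ w n ∧ w n ≤ R) (hb : HasBlocks w r R) :
    approxPointSpectrum T = {z : ℂ | r ≤ ‖z‖ ∧ ‖z‖ ≤ R} := by
  apply Set.Subset.antisymm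
  · intro z hz
    constructor
    · by_contra! h
      exact hz ⟨_, sub_pos.2 h, le_norm_shifted_of_le hT hr (fun n => (hw n).1) z⟩
    · by_contra! h
      exact hz ⟨_, sub_pos.2 ((shift_norm_le hT hr hw).trans_lt h),
        le_norm_shifted_of_norm_lt T z⟩
  · rintro z ⟨hrz, hzR⟩
    -- On the two boundary circles the growing and decaying profile is not available; flat blocks
    -- replace it.
    rcases hrz.eq_or_lt with h | hrz
    · refine mem_approxPointSpectrum_of_flat hT fun m ε hε => ?_
      obtain ⟨n, -, -, hn⟩ := hb 0 m 0 ε hε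
      exact ⟨n, by simpa [h] using hn⟩
    rcases hzR.eq_or_lt with h | hzR
    · refine mem_approxPointSpectrum_of_flat hT fun m ε hε => ?_
      obtain ⟨n, -, hn, -⟩ := hb m 0 0 ε hε
      exact ⟨n, by simpa [h] using hn⟩
    exact mem_approxPointSpectrum_of_hasBlocks hT hr hw hb hrz hzR

/-- By the open mapping theorem an injective operator with closed range is bounded below. -/
theorem mem_wolfSpectrum_of_injective {A : H →L[ℂ] H} {z : ℂ} (hz : z ∈ approxPointSpectrum A)
    (hinj : Function.Injective (shifted A z)) : z ∈ wolfSpectrum A := by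
  rintro ⟨hclosed, -⟩
  obtain ⟨K, hK⟩ := (shifted A z).antilipschitz_of_injective_of_isClosed_range hinj hclosed
  refine hz ⟨((K : ℝ) + 1)⁻¹, by positivity, fun x => ?_⟩
  have h := hK.le_mul_dist x 0
  rw [map_zero, dist_zero_right, dist_zero_right] at h
  rw [inv_mul_le_iff₀ (by positivity)]
  exact h.trans (by gcongr; linarith)

/-- Injectivity fails only for `z = 0` with some zero weight; then zero weights recur, and both
kernel and cokernel are too large. -/
theorem subset_wolfSpectrum (hT : ∀ n, T (e n) = (w n : ℂ) • e (n + 1)) (hr : 0 ≤ r)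
    (hw : ∀ n, r ≤ w n ∧ w n ≤ R) (hb : HasBlocks w r R)
    (hzero : (∀ n, w n ≠ 0) ∨ ∀ N, ∃ n ≥ N, w n = 0) :
    {z : ℂ | r ≤ ‖z‖ ∧ ‖z‖ ≤ R} ⊆ wolfSpectrum T := by
  intro z hz
  rw [← approxPointSpectrum_shift hT hr hw hb] at hz
  by_cases h : z ≠ 0 ∨ ∀ n, w n ≠ 0
  · exact mem_wolfSpectrum_of_injective hz (injective_shifted hT h)
  · push Not at h
    obtain ⟨rfl, n, hn⟩ := h
    obtain ⟨h1, h2⟩ := not_finiteDimensional_ker hT (hzero.resolve_left fun h => h n hn)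
    have h0 : shifted T 0 = T := by simp [shifted]
    change ¬ IsSemiFredholm (shifted T 0)
    rw [h0]
    rintro ⟨hclosed, hfin | hfin⟩
    · exact h1 hfin
    · exact h2 (quotientRangeEquiv T hclosed).finiteDimensional

theorem essSpectrum_shift (hT : ∀ n, T (e n) = (w n : ℂ) • e (n + 1)) (hr : 0 ≤ r)
    (hw : ∀ n, r ≤ w n ∧ w n ≤ R) (hb : HasBlocks w r R)
    (hzero : (∀ n, w n ≠ 0) ∨ ∀ N, ∃ n ≥ N, w n = 0) :
    essSpectrum T = {z : ℂ | r ≤ ‖z‖ ∧ ‖z‖ ≤ R} ∧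
      wolfSpectrum T = {z : ℂ | r ≤ ‖z‖ ∧ ‖z‖ ≤ R} := by
  have h1 := essSpectrum_subset hT hr hw
  have h2 := subset_wolfSpectrum hT hr hw hb hzero
  have h3 := wolfSpectrum_subset_essSpectrum T
  exact ⟨h1.antisymm (h2.trans h3), (h3.trans h1).antisymm h2⟩

theorem spectrum_shift (hT : ∀ n, T (e n) = (w n : ℂ) • e (n + 1)) (hr : 0 ≤ r)
    (hw : ∀ n, r ≤ w n ∧ w n ≤ R) (hb : HasBlocks w r R)
    (hzero : (∀ n, w n ≠ 0) ∨ ∀ N, ∃ n ≥ N, w n = 0) :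
    spectrum ℂ T = Metric.closedBall 0 R ∧ approxDefectSpectrum T = Metric.closedBall 0 R := by
  have := nontrivial_of_hilbertBasis e
  have h1 : spectrum ℂ T ⊆ Metric.closedBall 0 R := (spectrum.subset_closedBall_norm T).trans
    (Metric.closedBall_subset_closedBall (shift_norm_le hT hr hw))
  have h2 : Metric.closedBall 0 R ⊆ approxDefectSpectrum T := by
    intro z hz
    rw [mem_closedBall_zero_iff] at hz
    rcases lt_or_ge ‖z‖ r with h | h
    -- A surjective operator has index at least `0`, against the index `-1`.
    · intro hs
      have hi := (isFredholm_shifted_of_lt hT (fun n => (hw n).1) h).2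
      rw [index, LinearMap.range_eq_top.2 hs] at hi
      have h0 : Module.finrank ℂ (H ⧸ (⊤ : Submodule ℂ H)) = 0 :=
        Module.finrank_zero_of_subsingleton
      omega
    · exact wolfSpectrum_subset_approxDefectSpectrum T
        (subset_wolfSpectrum hT hr hw hb hzero ⟨h, hz⟩)
  have h3 := approxDefectSpectrum_subset_spectrum T
  exact ⟨h1.antisymm (h2.trans h3), (h3.trans h1).antisymm h2⟩

/-- A compact operator maps a weakly null sequence in the unit sphere, along a subsequence, to a
norm null sequence. -/
theorem exists_tendsto_compact {K : H →L[ℂ] H} (hK : IsCompactOperator K) {x : ℕ → H}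
    (hx : ∀ n, ‖x n‖ = 1) (hweak : ∀ v, Tendsto (fun n => (inner ℂ v (x n) : ℂ)) atTop (𝓝 0)) :
    ∃ φ : ℕ → ℕ, StrictMono φ ∧ Tendsto (fun n => K (x (φ n))) atTop (𝓝 0) := by
  obtain ⟨C, hC, hsub⟩ := hK.image_closedBall_subset_compact (f := (K : H →ₗ[ℂ] H)) 1
  obtain ⟨y, -, φ, hφ, hlim⟩ := hC.tendsto_subseq (x := fun n => K (x n)) fun n =>
    hsub ⟨x n, by simp [hx n], rfl⟩
  refine ⟨φ, hφ, ?_⟩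
  suffices y = 0 by rwa [this] at hlim
  -- Moving `K` to the other side shows that the norm limit `y` is also a weak limit of zero.
  have h1 : Tendsto (fun n => (inner ℂ y (K (x (φ n))) : ℂ)) atTop (𝓝 (inner ℂ y y)) :=
    tendsto_const_nhds.inner hlim
  have h2 : Tendsto (fun n => (inner ℂ y (K (x (φ n))) : ℂ)) atTop (𝓝 0) := by
    simp_rw [← ContinuousLinearMap.adjoint_inner_left]
    exact (hweak _).comp hφ.tendsto_atTop
  exact inner_self_eq_zero.1 (tendsto_nhds_unique h1 h2)

/-- Unit vectors moving to infinity keep the value `z` of the form of `T`, while `K` tends to zero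
on a subsequence of them. -/
theorem closedBall_subset_essNumericalRange (hT : ∀ n, T (e n) = (w n : ℂ) • e (n + 1))
    (hR : 0 < R) (hb : HasBlocks w r R) : Metric.closedBall 0 R ⊆ essNumericalRange T := by
  intro z hz K hK
  rw [← closure_ball (0 : ℂ) hR.ne'] at hz
  refine closure_minimal (fun z hz => ?_) isClosed_closure hz
  rw [mem_ball_zero_iff] at hz
  choose x hx hxz hxs using exists_unit_inner_eq hT hb hz
  obtain ⟨φ, -, hφ⟩ := exists_tendsto_compact hK hx (tendsto_inner_of_support hx hxs)
  have hlim : Tendsto (fun n => z + (inner ℂ (x (φ n)) (K (x (φ n))) : ℂ)) atTop (𝓝 (z + 0)) := by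
    refine tendsto_const_nhds.add (squeeze_zero_norm (fun n => ?_) (tendsto_norm_zero.comp hφ))
    simpa [hx] using norm_inner_le_norm (𝕜 := ℂ) (x (φ n)) (K (x (φ n)))
  rw [add_zero] at hlim
  refine mem_closure_of_tendsto hlim (Eventually.of_forall fun n => ⟨x (φ n), hx _, ?_⟩)
  rw [add_apply, inner_add_right, hxz]

theorem numericalRange_shift (hT : ∀ n, T (e n) = (w n : ℂ) • e (n + 1)) (hr : 0 ≤ r)
    (hR : 0 < R) (hw : ∀ n, r ≤ w n ∧ w n ≤ R) (hb : HasBlocks w r R) :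
    numericalRange T = Metric.ball 0 R := by
  refine Set.Subset.antisymm (fun z hz => ?_) fun z hz => ?_
  · have hTR := shift_norm_le hT hr hw
    have hzT := numericalRange_subset_closedBall T hz
    rw [mem_closedBall_zero_iff] at hzT
    rw [mem_ball_zero_iff]
    refine lt_of_le_of_ne (hzT.trans hTR) fun hzR => ?_
    obtain ⟨x, hx, rfl⟩ := hz
    have hx0 : x ≠ 0 := norm_ne_zero_iff.1 (by rw [hx]; exact one_ne_zero)
    have hle := T.le_opNorm x
    have hcs := norm_inner_le_norm (𝕜 := ℂ) x (T x)
    rw [hx, mul_one] at hle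
    rw [hx, one_mul] at hcs
    have hTx : ‖T x‖ = R := by linarith
    have hTx0 : T x ≠ 0 := norm_ne_zero_iff.1 (by rw [hTx]; exact hR.ne')
    -- Equality in Cauchy–Schwarz makes `x` an eigenvector with eigenvalue `c ≠ 0`, which a shift
    -- does not have.
    obtain ⟨c, hc, hcx⟩ := (norm_inner_eq_norm_iff (𝕜 := ℂ) hx0 hTx0).1
      (by rw [hzR, hx, hTx, one_mul])
    exact hx0 (eq_zero_of_shift_eq_smul hT hc hcx)
  · obtain ⟨x, hx, hxz, -⟩ := exists_unit_inner_eq hT hb (mem_ball_zero_iff.1 hz) 0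
    exact ⟨x, hx, hxz.symm⟩

theorem essNumericalRange_shift (hT : ∀ n, T (e n) = (w n : ℂ) • e (n + 1)) (hr : 0 ≤ r)
    (hR : 0 < R) (hw : ∀ n, r ≤ w n ∧ w n ≤ R) (hb : HasBlocks w r R) :
    essNumericalRange T = Metric.closedBall 0 R := by
  refine Set.Subset.antisymm (fun z hz => ?_) (closedBall_subset_essNumericalRange hT hR hb)
  have := hz 0 isCompactOperator_zero
  rwa [add_zero, numericalRange_shift hT hr hR hw hb, closure_ball _ hR.ne'] at this

/-- The point `R` of the essential numerical range bounds `‖T + K‖` from below for every compact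
`K`. -/
theorem norm_shift_eq (hT : ∀ n, T (e n) = (w n : ℂ) • e (n + 1)) (hr : 0 ≤ r)
    (hR : 0 < R) (hw : ∀ n, r ≤ w n ∧ w n ≤ R) (hb : HasBlocks w r R) :
    ‖T‖ = R ∧ essNorm T = R := by
  have hlow : ∀ K : H →L[ℂ] H, IsCompactOperator K → R ≤ ‖T + K‖ := by
    intro K hK
    have hRR : (R : ℂ) ∈ Metric.closedBall (0 : ℂ) R := by
      rw [mem_closedBall_zero_iff, Complex.norm_real, Real.norm_of_nonneg hR.le]
    have h := closure_minimal (numericalRange_subset_closedBall (T + K)) Metric.isClosed_closedBall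
      (closedBall_subset_essNumericalRange hT hR hb hRR K hK)
    rwa [mem_closedBall_zero_iff, Complex.norm_real, Real.norm_of_nonneg hR.le] at h
  have hnorm : ‖T‖ = R := (shift_norm_le hT hr hw).antisymm (by
    simpa using hlow 0 isCompactOperator_zero)
  have hmem : R ∈ {c | ∃ K : H →L[ℂ] H, IsCompactOperator K ∧ c = ‖T + K‖} :=
    ⟨0, isCompactOperator_zero, by rw [add_zero, hnorm]⟩
  refine ⟨hnorm, le_antisymm (csInf_le ⟨R, ?_⟩ hmem) (le_csInf ⟨R, hmem⟩ ?_)⟩ <;>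
  · rintro _ ⟨K, hK, rfl⟩
    exact hlow K hK

end Spectra

/-! ### Almost sure properties of the random weights. -/

section RandomWeights

open Filter Topology

variable {Ω : Type*} [MeasurableSpace Ω] {P : Measure Ω} {X : ℕ → Ω → ℝ}

/-- The essential range is the support of the law of `Y`, which has full measure. -/
theorem ae_mem_essRan {Y : Ω → ℝ} (hY : Measurable Y) : ∀ᵐ ω ∂P, Y ω ∈ essRan P Y := by
  refine ae_of_ae_map hY.aemeasurable ?_
  filter_upwards [Measure.support_mem_ae (μ := P.map Y)] with t ht ε hε
  have hU : {y : ℝ | |y - t| < ε} ∈ 𝓝 t := Metric.ball_mem_nhds t hε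
  have h := Measure.mem_support_iff_forall t |>.1 ht _ hU
  have hm : MeasurableSet {y : ℝ | |y - t| < ε} := measurableSet_ball (x := t) (ε := ε)
  rwa [Measure.map_apply hY hm] at h

theorem ae_forall_mem_Icc (hmeas : ∀ n, Measurable (X n))
    (hident : ∀ n, IdentDistrib (X n) (X 0) P P) {r R : ℝ} (hr : IsLeast (essRan P (X 0)) r)
    (hR : IsGreatest (essRan P (X 0)) R) : ∀ᵐ ω ∂P, ∀ n, r ≤ X n ω ∧ X n ω ≤ R := by
  refine ae_all_iff.2 fun n => ?_
  refine (hident n).symm.ae_mem_snd measurableSet_Icc ?_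
  filter_upwards [ae_mem_essRan (P := P) (hmeas 0)] with ω hω
  exact ⟨hr.2 hω, hR.2 hω⟩

theorem essRan_nonneg {Y : Ω → ℝ} (hY : ∀ᵐ ω ∂P, 0 ≤ Y ω) {t : ℝ} (ht : t ∈ essRan P Y) :
    0 ≤ t := by
  by_contra! h
  refine (ht (-t) (by linarith)).ne' (measure_mono_null (fun ω hω => ?_) hY)
  have := abs_lt.1 (show |Y ω - t| < -t from hω)
  exact not_le.2 (show Y ω < 0 by linarith)

/-- Every finite pattern of positive probability occurs arbitrarily far out. -/
theorem ae_exists_pattern [IsProbabilityMeasure P] (hmeas : ∀ n, Measurable (X n))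
    (hindep : iIndepFun X P) (hident : ∀ n, IdentDistrib (X n) (X 0) P P) {m : ℕ} (hm : 0 < m)
    {B : ℕ → Set ℝ} (hB : ∀ k, MeasurableSet (B k)) (hpos : ∀ k < m, P (X 0 ⁻¹' B k) ≠ 0) :
    ∀ᵐ ω ∂P, ∀ N, ∃ n ≥ N, ∀ k < m, X (n + k) ω ∈ B k := by
  -- Looking for the pattern only on disjoint windows makes the events independent, with one common
  -- positive probability.
  let I : ℕ → Finset ℕ := fun j => Finset.Ico (j * m) (j * m + m)
  let E : ℕ → Set Ω := fun j => ⋂ i ∈ I j, X i ⁻¹' B (i % m)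
  have hpre : ∀ i, MeasurableSet (X i ⁻¹' B (i % m)) := fun i => hmeas i (hB _)
  have hE : ∀ j, MeasurableSet (E j) := fun j => Finset.measurableSet_biInter _ fun i _ => hpre i
  have hPE : ∀ j, P (E j) = ∏ i ∈ I j, P (X i ⁻¹' B (i % m)) := fun j =>
    hindep.measure_inter_preimage_eq_mul (I j) fun i _ => hB (i % m)
  have hconst : ∀ j, P (E j) = ∏ k ∈ Finset.range m, P (X 0 ⁻¹' B k) := by
    intro j
    rw [hPE, Finset.prod_Ico_eq_prod_range, Nat.add_sub_cancel_left]
    refine Finset.prod_congr rfl fun k hk => ?_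
    rw [Nat.mul_add_mod_self_right, Nat.mod_eq_of_lt (Finset.mem_range.1 hk)]
    exact (hident _).measure_mem_eq (hB k)
  have hdisj : ∀ s : Finset ℕ, (s : Set ℕ).PairwiseDisjoint I := by
    intro s a _ b _ hab
    refine Finset.disjoint_left.2 fun i ha hb => hab ?_
    have key : ∀ j, i ∈ I j → i / m = j := fun j hj => by
      obtain ⟨h1, h2⟩ := Finset.mem_Ico.1 hj
      exact Nat.div_eq_of_lt_le h1 (by rw [Nat.succ_mul]; exact h2)
    rw [← key a ha, ← key b hb]
  have hind : iIndepSet E P := by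
    rw [iIndepSet_iff_meas_biInter hE]
    intro s
    have h1 : ⋂ j ∈ s, E j = ⋂ i ∈ s.biUnion I, X i ⁻¹' B (i % m) :=
      (Finset.set_biInter_biUnion s I _).symm
    rw [h1, hindep.measure_inter_preimage_eq_mul (s.biUnion I) fun i _ => hB (i % m),
      Finset.prod_biUnion (hdisj s)]
    exact Finset.prod_congr rfl fun j _ => (hPE j).symm
  have hsum : ∑' j, P (E j) = ∞ := by
    simp_rw [hconst]
    refine ENNReal.tsum_const_eq_top_of_ne_zero (Finset.prod_ne_zero_iff.2 fun k hk => ?_)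
    exact hpos k (Finset.mem_range.1 hk)
  have hlim := measure_limsup_eq_one hE hind hsum
  have hae : ∀ᵐ ω ∂P, ω ∈ limsup E atTop :=
    (prob_compl_eq_zero_iff (MeasurableSet.measurableSet_limsup hE)).2 hlim
  filter_upwards [hae] with ω hω N
  obtain ⟨j, hj, hωj⟩ := frequently_atTop.1 (mem_limsup_iff_frequently_mem.1 hω) N
  refine ⟨j * m, hj.trans (Nat.le_mul_of_pos_right j hm), fun k hk => ?_⟩
  have := Set.mem_iInter₂.1 hωj (j * m + k) (Finset.mem_Ico.2 ⟨by omega, by omega⟩)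
  rwa [Set.mem_preimage, Nat.mul_add_mod_self_right, Nat.mod_eq_of_lt hk] at this

theorem ae_hasBlocks [IsProbabilityMeasure P] (hmeas : ∀ n, Measurable (X n))
    (hindep : iIndepFun X P) (hident : ∀ n, IdentDistrib (X n) (X 0) P P) {r R : ℝ}
    (hr : r ∈ essRan P (X 0)) (hR : R ∈ essRan P (X 0)) :
    ∀ᵐ ω ∂P, HasBlocks (fun n => X n ω) r R := by
  -- The extra `+ 1` keeps the pattern nonempty when `p = q = 0`; the tolerances `1 / (j + 1)` leave
  -- countably many events.
  have h : ∀ p q j : ℕ, ∀ᵐ ω ∂P, ∀ N, ∃ n ≥ N, ∀ k < p + q + 1, X (n + k) ω ∈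
      (if k < p then Metric.ball R (1 / ((j : ℝ) + 1)) else Metric.ball r (1 / ((j : ℝ) + 1))) := by
    intro p q j
    refine ae_exists_pattern hmeas hindep hident (Nat.succ_pos _) (fun k => ?_) fun k _ => ?_
    · split_ifs <;> exact measurableSet_ball
    · split_ifs
      · exact (hR _ Nat.one_div_pos_of_nat).ne'
      · exact (hr _ Nat.one_div_pos_of_nat).ne'
  filter_upwards [ae_all_iff.2 fun p => ae_all_iff.2 fun q => ae_all_iff.2 (h p q)] with ω hω
  intro p q N ε hε
  obtain ⟨j, hj⟩ := exists_nat_one_div_lt hε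
  obtain ⟨n, hn, hk⟩ := hω p q j N
  refine ⟨n, hn, fun k hkp => ?_, fun k hkq => ?_⟩
  · have := hk k (by omega)
    rw [if_pos hkp] at this
    exact (Metric.mem_ball.1 this).trans hj
  · have := hk (p + k) (by omega)
    rw [if_neg (by omega), ← add_assoc] at this
    exact (Metric.mem_ball.1 this).trans hj

theorem ae_frequently_zero [IsProbabilityMeasure P] (hmeas : ∀ n, Measurable (X n))
    (hindep : iIndepFun X P) (hident : ∀ n, IdentDistrib (X n) (X 0) P P)
    (h0 : P {ω | X 0 ω = 0} ≠ 0) : ∀ᵐ ω ∂P, ∀ N, ∃ n ≥ N, X n ω = 0 := by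
  filter_upwards [ae_exists_pattern hmeas hindep hident zero_lt_one
    (B := fun _ => {0}) (fun _ => measurableSet_singleton 0) fun _ _ => h0] with ω hω N
  obtain ⟨n, hn, h⟩ := hω N
  exact ⟨n, hn, h 0 zero_lt_one⟩

theorem ae_ne_zero (hident : ∀ n, IdentDistrib (X n) (X 0) P P)
    (h0 : P {ω | X 0 ω = 0} = 0) : ∀ᵐ ω ∂P, ∀ n, X n ω ≠ 0 := by
  refine ae_all_iff.2 fun n => ?_
  exact (hident n).symm.ae_mem_snd (t := {0}ᶜ) (measurableSet_singleton 0).compl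
    (measure_eq_zero_iff_ae_notMem.1 h0)

/-! ### The geometric mean -/

theorem lintegral_ofReal_ne_top [IsFiniteMeasure P] {Y : Ω → ℝ} {c : ℝ}
    (hc : ∀ᵐ ω ∂P, Y ω ≤ c) : ∫⁻ ω, ENNReal.ofReal (Y ω) ∂P ≠ ∞ := by
  refine ((lintegral_mono_ae (hc.mono fun ω h => ENNReal.ofReal_le_ofReal h)).trans_lt ?_).ne
  rw [lintegral_const]
  exact ENNReal.mul_lt_top ENNReal.ofReal_lt_top (measure_lt_top _ _)

theorem integrable_of_lintegral_ne_top {Y : Ω → ℝ} (hY : Measurable Y)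
    (h1 : ∫⁻ ω, ENNReal.ofReal (Y ω) ∂P ≠ ∞) (h2 : ∫⁻ ω, ENNReal.ofReal (-Y ω) ∂P ≠ ∞) :
    Integrable Y P := by
  refine ⟨hY.aestronglyMeasurable, ?_⟩
  rw [hasFiniteIntegral_iff_norm]
  have hle : ∀ ω, ENNReal.ofReal ‖Y ω‖ ≤ ENNReal.ofReal (Y ω) + ENNReal.ofReal (-Y ω) := by
    intro ω
    rcases abs_cases (Y ω) with ⟨h, -⟩ | ⟨h, -⟩ <;> rw [Real.norm_eq_abs, h]
    · exact le_self_add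
    · exact le_add_self
  refine (lintegral_mono hle).trans_lt ?_
  rw [lintegral_add_left hY.ennreal_ofReal]
  exact ENNReal.add_lt_top.2 ⟨h1.lt_top, h2.lt_top⟩

theorem expectation_of_integrable {Y : Ω → ℝ} (hY : Integrable Y P) :
    expectation P Y = ((∫ ω, Y ω ∂P : ℝ) : EReal) := by
  have h1 : ∫⁻ ω, ENNReal.ofReal (Y ω) ∂P ≠ ∞ := hY.lintegral_lt_top.ne
  have h2 : ∫⁻ ω, ENNReal.ofReal (-Y ω) ∂P ≠ ∞ := hY.neg.lintegral_lt_top.ne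
  rw [integral_eq_lintegral_pos_part_sub_lintegral_neg_part hY, EReal.coe_sub,
    EReal.coe_ennreal_toReal h1, EReal.coe_ennreal_toReal h2, expectation]

theorem geomMean_of_integrable {Y : Ω → ℝ} (hY : Integrable (fun ω => Real.log (Y ω)) P) :
    geomMean P Y = ENNReal.ofReal (Real.exp (∫ ω, Real.log (Y ω) ∂P)) := by
  rw [geomMean, expectation_of_integrable hY, EReal.exp_coe]

/-- With the logarithm bounded above, integrability can fail only through the negative part. -/
theorem geomMean_of_not_integrable [IsFiniteMeasure P] {Y : Ω → ℝ} (hmeas : Measurable Y) {c : ℝ}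
    (hc : ∀ᵐ ω ∂P, Real.log (Y ω) ≤ c) (hY : ¬ Integrable (fun ω => Real.log (Y ω)) P) :
    geomMean P Y = 0 := by
  have h1 := lintegral_ofReal_ne_top hc
  have h2 : ∫⁻ ω, ENNReal.ofReal (-Real.log (Y ω)) ∂P = ∞ := by
    by_contra h2
    exact hY (integrable_of_lintegral_ne_top hmeas.log h1 h2)
  rw [geomMean, expectation, h2, EReal.coe_ennreal_top, EReal.sub_top, EReal.exp_bot]

/-! ### Convergence of the series of squared products -/

/-- Once the averages of `log (w i)` exceed some `M > log t`, the terms are dominated by a geometric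
series. -/
theorem summable_sq_prod_of_tendsto {w : ℕ → ℝ} (hw : ∀ n, 0 < w n) {L t : ℝ} (ht : 0 < t)
    (hL : Tendsto (fun n : ℕ => (∑ i ∈ Finset.range n, Real.log (w i)) / n) atTop (𝓝 L))
    (htL : Real.log t < L) : Summable fun n => (∏ i ∈ Finset.range n, t / w i) ^ 2 := by
  obtain ⟨M, htM, hML⟩ := exists_between htL
  have hprod : ∀ n, ∏ i ∈ Finset.range n, t / w i =
      Real.exp (n * Real.log t - ∑ i ∈ Finset.range n, Real.log (w i)) := by
    intro n
    have : n * Real.log t - ∑ i ∈ Finset.range n, Real.log (w i) =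
        ∑ i ∈ Finset.range n, Real.log (t / w i) := by
      simp_rw [Real.log_div ht.ne' (hw _).ne', Finset.sum_sub_distrib]
      simp
    rw [this, Real.exp_sum]
    exact Finset.prod_congr rfl fun i _ => (Real.exp_log (div_pos ht (hw i))).symm
  have hgeo : Summable fun n : ℕ => Real.exp (2 * (Real.log t - M)) ^ n :=
    summable_geometric_of_lt_one (Real.exp_nonneg _) (Real.exp_lt_one_iff.2 (by linarith))
  refine hgeo.of_norm_bounded_eventually_nat ?_
  filter_upwards [hL.eventually_const_lt hML, eventually_gt_atTop 0] with n hn hn0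
  rw [lt_div_iff₀ (by exact_mod_cast hn0)] at hn
  rw [Real.norm_of_nonneg (sq_nonneg _), hprod, ← Real.exp_nat_mul, ← Real.exp_nat_mul,
    Real.exp_le_exp]
  push_cast
  nlinarith

/-! ### Divergence of the series of squared products -/

/-- If `U`, `V ≥ 0` have the same law and `U - V ≤ d`, then `0 ≤ E (U - V)`, without any
integrability assumption. -/
theorem lintegral_sub_le_of_identDistrib [IsProbabilityMeasure P] {U V : Ω → ℝ}
    (hU : Measurable U) (hV : Measurable V) (hUV : IdentDistrib U V P P) (hU0 : ∀ ω, 0 ≤ U ω)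
    (hV0 : ∀ ω, 0 ≤ V ω) {d : ℝ} (hd0 : 0 ≤ d) (hd : ∀ᵐ ω ∂P, U ω - V ω ≤ d) :
    ∫⁻ ω, ENNReal.ofReal (d - (U ω - V ω)) ∂P ≤ ENNReal.ofReal d := by
  -- Truncation gives integrable variables of equal mean and, as `0 ≤ d`, keeps the bound `d`;
  -- Fatou's lemma removes it.
  let f : ℕ → Ω → ℝ := fun k ω => d - (min (U ω) k - min (V ω) k)
  have hint : ∀ (Z : Ω → ℝ), Measurable Z → (∀ ω, 0 ≤ Z ω) → ∀ k : ℕ,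
      Integrable (fun ω => min (Z ω) (k : ℝ)) P := fun Z hZ hZ0 k =>
    Integrable.of_bound (hZ.min measurable_const).aestronglyMeasurable (k : ℝ)
      (ae_of_all _ fun ω => by
        rw [Real.norm_of_nonneg (le_min (hZ0 ω) k.cast_nonneg)]
        exact min_le_right _ _)
  have hfmeas : ∀ k, Measurable fun ω => ENNReal.ofReal (f k ω) := fun k => by
    simp only [f]; fun_prop
  have hfint : ∀ k, ∫⁻ ω, ENNReal.ofReal (f k ω) ∂P = ENNReal.ofReal d := by
    intro k
    have hiU := hint U hU hU0 k
    have hiV := hint V hV hV0 k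
    have heq : ∫ ω, min (U ω) (k : ℝ) ∂P = ∫ ω, min (V ω) (k : ℝ) ∂P :=
      (hUV.comp (u := fun x => min x (k : ℝ)) (by fun_prop)).integral_eq
    have hsub : Integrable (fun ω => min (U ω) (k : ℝ) - min (V ω) (k : ℝ)) P := hiU.sub hiV
    have hif : Integrable (f k) P := (integrable_const d).sub hsub
    rw [← ofReal_integral_eq_lintegral_ofReal hif]
    · simp only [f]
      rw [integral_sub (integrable_const d) hsub, integral_sub hiU hiV, heq]
      simp
    · filter_upwards [hd] with ω hω
      have : min (U ω) (k : ℝ) ≤ min (V ω) k + d := by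
        rw [← min_add_add_right]
        exact min_le_min (by linarith) (by linarith)
      simp only [Pi.zero_apply]
      linarith
  calc ∫⁻ ω, ENNReal.ofReal (d - (U ω - V ω)) ∂P
      = ∫⁻ ω, liminf (fun k => ENNReal.ofReal (f k ω)) atTop ∂P := by
        refine lintegral_congr fun ω => (Tendsto.liminf_eq ?_).symm
        refine tendsto_const_nhds.congr' ?_
        obtain ⟨k₀, hk₀⟩ := exists_nat_ge (max (U ω) (V ω))
        filter_upwards [eventually_ge_atTop k₀] with k hk
        have hk' : max (U ω) (V ω) ≤ k := hk₀.trans (by exact_mod_cast hk)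
        simp only [f]
        rw [min_eq_left ((le_max_left _ _).trans hk'), min_eq_left ((le_max_right _ _).trans hk')]
    _ ≤ liminf (fun k => ∫⁻ ω, ENNReal.ofReal (f k ω) ∂P) atTop := lintegral_liminf_le hfmeas
    _ = ENNReal.ofReal d := by simp_rw [hfint]; exact liminf_const _

theorem indepFun_zero_tail (hmeas : ∀ n, Measurable (X n)) (hindep : iIndepFun X P) :
    IndepFun (X 0) (fun ω n => X (n + 1) ω) P := by
  rw [IndepFun_iff_Indep]
  have h := indep_iSup_of_disjoint (fun i => (hmeas i).comap_le) hindep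
    (disjoint_compl_right (a := ({0} : Set ℕ)))
  refine indep_of_indep_of_le_left (indep_of_indep_of_le_right h ?_) ?_
  · rw [MeasurableSpace.pi, MeasurableSpace.comap_iSup]
    refine iSup_le fun n => ?_
    rw [MeasurableSpace.comap_comp]
    exact le_iSup₂_of_le (n + 1) (by simp) le_rfl
  · exact le_iSup₂_of_le 0 rfl le_rfl

theorem identDistrib_tail [IsProbabilityMeasure P] (hmeas : ∀ n, Measurable (X n))
    (hindep : iIndepFun X P) (hident : ∀ n, IdentDistrib (X n) (X 0) P P) :
    IdentDistrib (fun ω n => X (n + 1) ω) (fun ω n => X n ω) P P where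
  aemeasurable_fst := (measurable_pi_lambda _ fun n => hmeas (n + 1)).aemeasurable
  aemeasurable_snd := (measurable_pi_lambda _ fun n => hmeas n).aemeasurable
  map_eq := by
    have h1 := (hindep.precomp (add_left_injective 1)).map_fun_eq_infinitePi_map
      fun n => hmeas (n + 1)
    rw [h1, hindep.map_fun_eq_infinitePi_map hmeas]
    congr 1
    ext1 n
    exact ((hident _).trans (hident n).symm).map_eq

/-- The sum of the squared products `(t / x 0) ⋯ (t / x (n - 1))`. -/
def sumSqProd (t : ℝ) (x : ℕ → ℝ) : ℝ≥0∞ :=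
  ∑' n, ∏ i ∈ Finset.range n, ENNReal.ofReal (t / x i) ^ 2

theorem measurable_sumSqProd (t : ℝ) : Measurable (sumSqProd t) :=
  Measurable.tsum fun _ => Finset.measurable_fun_prod _ fun i _ =>
    ((measurable_const.div (measurable_pi_apply i)).ennreal_ofReal).pow_const 2

/-- Every term but the first has a factor from `x 0`. This self-similarity drives the divergence
proof. -/
theorem sumSqProd_eq (t : ℝ) (x : ℕ → ℝ) :
    sumSqProd t x = 1 + ENNReal.ofReal (t / x 0) ^ 2 * sumSqProd t fun n => x (n + 1) := by
  rw [sumSqProd, tsum_eq_zero_add' ENNReal.summable]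
  simp_rw [Finset.prod_range_succ', ENNReal.tsum_mul_right]
  rw [Finset.prod_range_zero, mul_comm]
  rfl

theorem one_le_sumSqProd (t : ℝ) (x : ℕ → ℝ) : 1 ≤ sumSqProd t x := by
  rw [sumSqProd_eq]; exact le_self_add

theorem sumSqProd_ne_top_of_summable {t : ℝ} {x : ℕ → ℝ} (ht : 0 ≤ t) (hx : ∀ n, 0 < x n)
    (h : Summable fun n => (∏ i ∈ Finset.range n, t / x i) ^ 2) : sumSqProd t x ≠ ∞ := by
  have heq : ∀ n, ∏ i ∈ Finset.range n, ENNReal.ofReal (t / x i) ^ 2 =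
      ENNReal.ofReal ((∏ i ∈ Finset.range n, t / x i) ^ 2) := by
    intro n
    have h0 : ∀ i, 0 ≤ t / x i := fun i => div_nonneg ht (hx i).le
    rw [ENNReal.ofReal_pow (Finset.prod_nonneg fun i _ => h0 i),
      ENNReal.ofReal_prod_of_nonneg fun i _ => h0 i, Finset.prod_pow]
  rw [sumSqProd]
  simp_rw [heq]
  rw [← ENNReal.ofReal_tsum_of_nonneg (fun n => sq_nonneg _) h]
  exact ENNReal.ofReal_ne_top

/-- `log` of `sumSqProd`, with the value `0` where the sum is infinite. -/
def logSumSqProd (t : ℝ) (x : ℕ → ℝ) : ℝ := Real.log (sumSqProd t x).toReal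

theorem logSumSqProd_nonneg (t : ℝ) (x : ℕ → ℝ) : 0 ≤ logSumSqProd t x := by
  by_cases h : sumSqProd t x = ∞
  · simp [logSumSqProd, h]
  · refine Real.log_nonneg ?_
    rw [← ENNReal.toReal_one]
    exact ENNReal.toReal_mono h (one_le_sumSqProd t x)

/-- The sum and its tail are infinite together, and the default value `0` then makes their
logarithms cancel. -/
theorem logSumSqProd_eq_of_tail_eq_top {t : ℝ} {x : ℕ → ℝ} (ht : 0 < t) (hx : 0 < x 0)
    (h : sumSqProd t (fun n => x (n + 1)) = ∞) :
    logSumSqProd t x = 0 ∧ logSumSqProd t (fun n => x (n + 1)) = 0 := by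
  have h' : sumSqProd t x = ∞ := by
    rw [sumSqProd_eq, h, ENNReal.mul_top, add_top]
    exact pow_ne_zero 2 (ENNReal.ofReal_pos.2 (div_pos ht hx)).ne'
  simp [logSumSqProd, h, h']

/-- The strictness comes from the summand `1` in the recursion; it settles the critical value of
`t`. -/
theorem lt_logSumSqProd_of_tail_ne_top {t : ℝ} {x : ℕ → ℝ} (ht : 0 < t) (hx : 0 < x 0)
    (h : sumSqProd t (fun n => x (n + 1)) ≠ ∞) :
    2 * (Real.log t - Real.log (x 0)) + logSumSqProd t (fun n => x (n + 1)) <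
      logSumSqProd t x := by
  have hpos : 0 < t / x 0 := div_pos ht hx
  have hS : 0 < (sumSqProd t fun n => x (n + 1)).toReal :=
    ENNReal.toReal_pos (zero_lt_one.trans_le (one_le_sumSqProd _ _)).ne' h
  have h1 : (sumSqProd t x).toReal =
      1 + (t / x 0) ^ 2 * (sumSqProd t fun n => x (n + 1)).toReal := by
    rw [sumSqProd_eq, ENNReal.toReal_add ENNReal.one_ne_top
      (ENNReal.mul_ne_top (ENNReal.pow_ne_top ENNReal.ofReal_ne_top) h), ENNReal.toReal_mul,
      ENNReal.toReal_pow, ENNReal.toReal_ofReal hpos.le, ENNReal.toReal_one]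
  have h2 : 2 * (Real.log t - Real.log (x 0)) + logSumSqProd t (fun n => x (n + 1)) =
      Real.log ((t / x 0) ^ 2 * (sumSqProd t fun n => x (n + 1)).toReal) := by
    rw [Real.log_mul (by positivity) hS.ne', Real.log_pow, Real.log_div ht.ne' hx.ne',
      logSumSqProd]
    push_cast
    ring
  rw [h2, logSumSqProd, h1]
  exact Real.log_lt_log (by positivity) (by linarith)

/-- A mean lower bound for `log C - log Y`, valid also if `log Y` is not integrable. -/
theorem ofReal_le_lintegral_log_sub [IsProbabilityMeasure P] {Y : Ω → ℝ} (hY : Measurable Y)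
    {C t : ℝ} (hC : ∀ᵐ ω ∂P, Real.log (Y ω) ≤ Real.log C)
    (ht : Integrable (fun ω => Real.log (Y ω)) P → ∫ ω, Real.log (Y ω) ∂P ≤ Real.log t) :
    ENNReal.ofReal (2 * (Real.log C - Real.log t)) ≤
      ∫⁻ ω, ENNReal.ofReal (2 * (Real.log C - Real.log (Y ω))) ∂P := by
  have hmeas : Measurable fun ω => 2 * (Real.log C - Real.log (Y ω)) :=
    (measurable_const.sub hY.log).const_mul 2
  have hnonneg : 0 ≤ᵐ[P] fun ω => 2 * (Real.log C - Real.log (Y ω)) := by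
    filter_upwards [hC] with ω hω
    simp only [Pi.zero_apply]
    linarith
  by_cases h : ∫⁻ ω, ENNReal.ofReal (2 * (Real.log C - Real.log (Y ω))) ∂P = ∞
  · rw [h]; exact le_top
  have hint : Integrable (fun ω => 2 * (Real.log C - Real.log (Y ω))) P := by
    refine integrable_of_lintegral_ne_top hmeas h (lintegral_ofReal_ne_top (c := 0) ?_)
    filter_upwards [hnonneg] with ω hω
    simpa using hω
  have hlog : Integrable (fun ω => Real.log (Y ω)) P := by
    refine ((integrable_const (Real.log C)).sub (hint.const_mul (1 / 2))).congr
      (ae_of_all _ fun ω => ?_)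
    simp only [Pi.sub_apply]
    ring
  rw [← ofReal_integral_eq_lintegral_ofReal hint hnonneg, integral_const_mul,
    integral_sub (integrable_const _) hlog]
  refine ENNReal.ofReal_le_ofReal ?_
  have := ht hlog
  simp only [integral_const, probReal_univ, one_smul]
  linarith

/-- Let `A` be the event that the tail sum is finite. On `A` the variable `d - (U - V)` exceeds `g
(X 0)`, whose integral over `A` is at least `d * P A` by independence; off `A` it equals `d`. If `P
A > 0`, its mean would exceed `d`, against `lintegral_sub_le_of_identDistrib`. The implication in
`hE` lets it cover the mean `-∞`. -/
theorem ae_sumSqProd_eq_top [IsProbabilityMeasure P] (hmeas : ∀ n, Measurable (X n))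
    (hindep : iIndepFun X P) (hident : ∀ n, IdentDistrib (X n) (X 0) P P)
    (hpos : ∀ᵐ ω ∂P, 0 < X 0 ω) {C : ℝ} (hC : ∀ᵐ ω ∂P, X 0 ω ≤ C) {t : ℝ} (ht : 0 < t)
    (hE : Integrable (fun ω => Real.log (X 0 ω)) P → ∫ ω, Real.log (X 0 ω) ∂P ≤ Real.log t) :
    ∀ᵐ ω ∂P, sumSqProd t (fun n => X n ω) = ∞ := by
  wlog htC : t ≤ C generalizing C
  · exact this (hC.mono fun ω h => h.trans (le_max_left C t)) (le_max_right C t)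
  have hlogC : ∀ᵐ ω ∂P, Real.log (X 0 ω) ≤ Real.log C := by
    filter_upwards [hpos, hC] with ω h1 h2 using Real.log_le_log h1 h2
  set d := 2 * (Real.log C - Real.log t) with hd
  have hd0 : 0 ≤ d := by have := Real.log_le_log ht htC; linarith
  let Z : Ω → ℕ → ℝ := fun ω n => X (n + 1) ω
  let Z₀ : Ω → ℕ → ℝ := fun ω n => X n ω
  have hZ : Measurable Z := measurable_pi_lambda _ fun n => hmeas (n + 1)
  have hZ₀ : Measurable Z₀ := measurable_pi_lambda _ fun n => hmeas n
  have hid : IdentDistrib Z Z₀ P P := identDistrib_tail hmeas hindep hident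
  have hlogm : Measurable (logSumSqProd t) := (measurable_sumSqProd t).ennreal_toReal.log
  let U : Ω → ℝ := fun ω => logSumSqProd t (Z ω)
  let V : Ω → ℝ := fun ω => logSumSqProd t (Z₀ ω)
  have hU : Measurable U := hlogm.comp hZ
  have hV : Measurable V := hlogm.comp hZ₀
  let S : Set (ℕ → ℝ) := {x | sumSqProd t x ≠ ∞}
  have hS : MeasurableSet S := (measurable_sumSqProd t (measurableSet_singleton ∞)).compl
  let A : Set Ω := Z ⁻¹' S
  have hA : MeasurableSet A := hZ hS
  let g : ℝ → ℝ≥0∞ := fun y => ENNReal.ofReal (2 * (Real.log C - Real.log y))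
  have hg : Measurable g :=
    ((measurable_const.sub Real.measurable_log).const_mul 2).ennreal_ofReal
  have hon : ∀ᵐ ω ∂P, ω ∈ A → g (X 0 ω) < ENNReal.ofReal (d - (U ω - V ω)) := by
    filter_upwards [hpos, hlogC] with ω h1 h2 hω
    have h3 := lt_logSumSqProd_of_tail_ne_top (x := Z₀ ω) ht h1 hω
    have h4 : 2 * (Real.log C - Real.log (X 0 ω)) < d - (U ω - V ω) := by
      change 2 * (Real.log t - Real.log (X 0 ω)) + U ω < V ω at h3
      linarith
    exact (ENNReal.ofReal_lt_ofReal_iff (lt_of_le_of_lt (by linarith) h4)).2 h4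
  have hoff : ∀ᵐ ω ∂P, ω ∈ Aᶜ → ENNReal.ofReal (d - (U ω - V ω)) = ENNReal.ofReal d := by
    filter_upwards [hpos] with ω h1 hω
    obtain ⟨h2, h3⟩ := logSumSqProd_eq_of_tail_eq_top (x := Z₀ ω) ht h1 (not_not.1 hω)
    have h4 : U ω = 0 := h3
    have h5 : V ω = 0 := h2
    rw [h4, h5, sub_zero, sub_zero]
  have hUVd : ∀ᵐ ω ∂P, U ω - V ω ≤ d := by
    filter_upwards [hpos, hlogC] with ω h1 h2
    by_cases hω : ω ∈ A
    · have h3 := lt_logSumSqProd_of_tail_ne_top (x := Z₀ ω) ht h1 hω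
      change 2 * (Real.log t - Real.log (X 0 ω)) + U ω < V ω at h3
      linarith
    · obtain ⟨h2, h3⟩ := logSumSqProd_eq_of_tail_eq_top (x := Z₀ ω) ht h1 (not_not.1 hω)
      have h4 : U ω = 0 := h3
      have h5 : V ω = 0 := h2
      rw [h4, h5, sub_zero]
      exact hd0
  have htotal := lintegral_sub_le_of_identDistrib hU hV (hid.comp hlogm)
    (fun ω => logSumSqProd_nonneg _ _) (fun ω => logSumSqProd_nonneg _ _) hd0 hUVd
  have hindA : ∫⁻ ω in A, g (X 0 ω) ∂P = (∫⁻ ω, g (X 0 ω) ∂P) * P A := by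
    have hi : Measurable (S.indicator (1 : (ℕ → ℝ) → ℝ≥0∞)) := measurable_one.indicator hS
    have h := lintegral_mul_eq_lintegral_mul_lintegral_of_indepFun (hg.comp (hmeas 0))
      (hi.comp hZ) ((indepFun_zero_tail hmeas hindep).comp hg hi)
    have h1 : ∫⁻ ω, (S.indicator (1 : (ℕ → ℝ) → ℝ≥0∞) ∘ Z) ω ∂P = P A := by
      rw [← lintegral_indicator_one hA]; rfl
    rw [h1] at h
    rw [← lintegral_indicator hA]
    refine Eq.trans (lintegral_congr fun ω => ?_) h
    by_cases hω : ω ∈ A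
    · have hω' : Z ω ∈ S := hω
      simp [hω, hω']
    · have hω' : Z ω ∉ S := hω
      simp [hω, hω']
  have hPA : P A = 0 := by
    by_contra hPA
    have hfin : ∫⁻ ω in A, ENNReal.ofReal (d - (U ω - V ω)) ∂P ≠ ∞ :=
      ((setLIntegral_le_lintegral _ _).trans htotal).trans_lt ENNReal.ofReal_lt_top |>.ne
    have hle : ∫⁻ ω in A, g (X 0 ω) ∂P ≤ ∫⁻ ω in A, ENNReal.ofReal (d - (U ω - V ω)) ∂P :=
      setLIntegral_mono_ae' hA (hon.mono fun ω h hω => (h hω).le)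
    -- Strictness survives integration because the smaller integral is finite, thanks to `htotal`.
    have hlt := setLIntegral_strict_mono hA hPA
      (measurable_const.sub (hU.sub hV)).ennreal_ofReal (hle.trans_lt hfin.lt_top).ne hon
    have h1 : ENNReal.ofReal d * P A ≤ ∫⁻ ω in A, g (X 0 ω) ∂P := by
      rw [hindA]
      gcongr
      exact ofReal_le_lintegral_log_sub (hmeas 0) hlogC hE
    have h2 : ∫⁻ ω in Aᶜ, ENNReal.ofReal (d - (U ω - V ω)) ∂P = ENNReal.ofReal d * P Aᶜ := by
      rw [setLIntegral_congr_fun_ae hA.compl hoff, setLIntegral_const]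
    have h3 : ENNReal.ofReal d < ∫⁻ ω, ENNReal.ofReal (d - (U ω - V ω)) ∂P := by
      rw [← lintegral_add_compl _ hA, h2]
      calc ENNReal.ofReal d = ENNReal.ofReal d * P A + ENNReal.ofReal d * P Aᶜ := by
            rw [← mul_add, prob_add_prob_compl hA, mul_one]
        _ < _ := ENNReal.add_lt_add_right
            (ENNReal.mul_ne_top ENNReal.ofReal_ne_top (measure_ne_top _ _)) (h1.trans_lt hlt)
    exact (h3.trans_le htotal).false
  have hZtop : ∀ᵐ ω ∂P, Z ω ∈ Sᶜ := measure_eq_zero_iff_ae_notMem.1 hPA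
  -- Divergence is known for the tail, which has the law of the whole sequence.
  filter_upwards [hid.ae_mem_snd hS.compl hZtop] with ω hω
  exact not_not.1 hω

/-- Almost surely, the series of squared products converges exactly below the geometric mean. -/
theorem ae_summable_sq_prod_iff [IsProbabilityMeasure P] (hmeas : ∀ n, Measurable (X n))
    (hindep : iIndepFun X P) (hident : ∀ n, IdentDistrib (X n) (X 0) P P)
    (hpos : ∀ᵐ ω ∂P, ∀ n, 0 < X n ω) {C : ℝ} (hC : ∀ᵐ ω ∂P, X 0 ω ≤ C) :
    ∀ᵐ ω ∂P, ∀ t > 0, (Summable fun n => (∏ i ∈ Finset.range n, t / X i ω) ^ 2) ↔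
      ENNReal.ofReal t < geomMean P (X 0) := by
  have hpos0 : ∀ᵐ ω ∂P, 0 < X 0 ω := hpos.mono fun ω h => h 0
  -- Monotonicity in `t` reduces divergence to the critical value, or to countably many `t`, so that
  -- one null set serves all `t`.
  have hmono : ∀ {w : ℕ → ℝ}, (∀ n, 0 < w n) → ∀ {s t : ℝ}, 0 ≤ s → s ≤ t →
      (Summable fun n => (∏ i ∈ Finset.range n, t / w i) ^ 2) →
      Summable fun n => (∏ i ∈ Finset.range n, s / w i) ^ 2 := by
    intro w hw s t hs hst h
    refine Summable.of_nonneg_of_le (fun _ => sq_nonneg _) (fun n => ?_) h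
    have h0 : ∀ i, 0 ≤ s / w i := fun i => div_nonneg hs (hw i).le
    refine pow_le_pow_left₀ (Finset.prod_nonneg fun i _ => h0 i) ?_ 2
    refine Finset.prod_le_prod (fun i _ => h0 i) fun i _ => ?_
    have := (hw i).le
    gcongr
  by_cases hint : Integrable (fun ω => Real.log (X 0 ω)) P
  · set L := ∫ ω, Real.log (X 0 ω) ∂P with hL
    have hdiv := ae_sumSqProd_eq_top hmeas hindep hident hpos0 hC (Real.exp_pos L)
      fun _ => by rw [Real.log_exp]
    have hslln := strong_law_ae_real (fun n ω => Real.log (X n ω)) hint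
      (fun i j hij => (hindep.indepFun hij).comp Real.measurable_log Real.measurable_log)
      fun n => (hident n).comp Real.measurable_log
    filter_upwards [hpos, hdiv, hslln] with ω hω h1 h2 t ht
    rw [geomMean_of_integrable hint, ENNReal.ofReal_lt_ofReal_iff (Real.exp_pos _)]
    constructor
    · intro h
      by_contra! hle
      exact sumSqProd_ne_top_of_summable (Real.exp_pos L).le hω
        (hmono hω (Real.exp_pos L).le hle h) h1
    · intro h
      exact summable_sq_prod_of_tendsto hω ht h2 ((Real.log_lt_iff_lt_exp ht).2 h)
  · have hdiv : ∀ᵐ ω ∂P, ∀ k : ℕ, sumSqProd (1 / ((k : ℝ) + 1)) (fun n => X n ω) = ∞ :=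
      ae_all_iff.2 fun k => ae_sumSqProd_eq_top hmeas hindep hident hpos0 hC
        Nat.one_div_pos_of_nat fun h => absurd h hint
    have hlogC : ∀ᵐ ω ∂P, Real.log (X 0 ω) ≤ Real.log C := by
      filter_upwards [hpos0, hC] with ω h1 h2 using Real.log_le_log h1 h2
    filter_upwards [hpos, hdiv] with ω hω h1 t ht
    rw [geomMean_of_not_integrable (hmeas 0) hlogC hint]
    refine iff_of_false (fun h => ?_) not_lt_zero
    obtain ⟨k, hk⟩ := exists_nat_one_div_lt ht
    exact sumSqProd_ne_top_of_summable Nat.one_div_pos_of_nat.le hω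
      (hmono hω Nat.one_div_pos_of_nat.le hk.le h) (h1 k)

end RandomWeights

end RandomShift

end

theorem theorem3p1
    {H : Type*} [NormedAddCommGroup H] [InnerProductSpace ℂ H] [CompleteSpace H]
    (e : HilbertBasis ℕ ℂ H)
    {Ω : Type*} [MeasurableSpace Ω] (P : Measure Ω) [IsProbabilityMeasure P]
    (X : ℕ → Ω → ℝ)
    (hmeas : ∀ n, Measurable (X n))
    (hindep : iIndepFun X P)
    (hident : ∀ n, IdentDistrib (X n) (X 0) P P)
    (hnonneg : ∀ n, ∀ᵐ ω ∂P, 0 ≤ X n ω)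
    (hbdd : ∃ C : ℝ, ∀ n, ∀ᵐ ω ∂P, X n ω ≤ C)
    (r R : ℝ)
    (hr : IsLeast (RandomShift.essRan P (X 0)) r)
    (hR : IsGreatest (RandomShift.essRan P (X 0)) R)
    (hRpos : 0 < R)
    (T : Ω → H →L[ℂ] H)
    (hT : T = fun ω => RandomShift.weightedShift e (fun n => X n ω)) :
    -- almost every sample is the bounded weighted shift with the given weights
    (∀ᵐ ω ∂P, ∀ n, T ω (e n) = (X n ω : ℂ) • e (n + 1)) ∧
    -- norm, essential norm, spectral radius, numerical radius
    (∀ᵐ ω ∂P, ‖T ω‖ = R ∧ RandomShift.essNorm (T ω) = R ∧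
      spectralRadius ℂ (T ω) = ENNReal.ofReal R ∧ RandomShift.numericalRadius (T ω) = R) ∧
    -- spectrum and approximate defect spectrum
    (∀ᵐ ω ∂P, spectrum ℂ (T ω) = Metric.closedBall 0 R ∧
      RandomShift.approxDefectSpectrum (T ω) = Metric.closedBall 0 R) ∧
    -- approximate point, essential and Wolf spectra; the index
    (∀ᵐ ω ∂P, RandomShift.approxPointSpectrum (T ω) = {z : ℂ | r ≤ ‖z‖ ∧ ‖z‖ ≤ R} ∧
      RandomShift.essSpectrum (T ω) = {z : ℂ | r ≤ ‖z‖ ∧ ‖z‖ ≤ R} ∧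
      RandomShift.wolfSpectrum (T ω) = {z : ℂ | r ≤ ‖z‖ ∧ ‖z‖ ≤ R}) ∧
    (∀ᵐ ω ∂P, ∀ z ∈ Metric.ball (0 : ℂ) r,
      (RandomShift.shifted (T ω) z).IsFredholm ∧
        RandomShift.index (RandomShift.shifted (T ω) z) = -1) ∧
    -- point spectra when zero weights occur with positive probability
    (0 < P {ω | X 0 ω = 0} →
      ∀ᵐ ω ∂P, RandomShift.pointSpectrum (T ω) = {0} ∧
        RandomShift.pointSpectrum (ContinuousLinearMap.adjoint (T ω)) = {0} ∧
        ¬ FiniteDimensional ℂ (T ω).ker ∧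
        ¬ FiniteDimensional ℂ (ContinuousLinearMap.adjoint (T ω)).ker) ∧
    -- point spectra when the weights are almost surely positive
    (P {ω | X 0 ω = 0} = 0 →
      ∀ᵐ ω ∂P, RandomShift.pointSpectrum (T ω) = ∅ ∧
        RandomShift.pointSpectrum (ContinuousLinearMap.adjoint (T ω)) =
          {0} ∪ {z : ℂ | ENNReal.ofReal ‖z‖ < RandomShift.geomMean P (X 0)} ∧
        ∀ z ∈ RandomShift.pointSpectrum (ContinuousLinearMap.adjoint (T ω)),
          Module.finrank ℂ (RandomShift.shifted (ContinuousLinearMap.adjoint (T ω)) z).ker = 1) ∧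
    -- numerical range and essential numerical range
    (∀ᵐ ω ∂P, RandomShift.numericalRange (T ω) = Metric.ball 0 R) ∧
    (∀ᵐ ω ∂P, RandomShift.essNumericalRange (T ω) = Metric.closedBall 0 R) := by
  subst hT
  have hr0 : 0 ≤ r := RandomShift.essRan_nonneg (hnonneg 0) hr.1
  have hmem := RandomShift.ae_forall_mem_Icc hmeas hident hr hR
  have hblocks := RandomShift.ae_hasBlocks hmeas hindep hident hr.1 hR.1
  have hbasis : ∀ᵐ ω ∂P, ∀ n, RandomShift.weightedShift e (fun n => X n ω) (e n) =
      (X n ω : ℂ) • e (n + 1) := by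
    filter_upwards [hmem] with ω hω n
    exact RandomShift.weightedShift_apply_basis e
      ⟨R, fun n => by rw [abs_of_nonneg (hr0.trans (hω n).1)]; exact (hω n).2⟩ n
  -- This excludes finitely many zero weights, for which `0` might not lie in the Wolf spectrum.
  have hzero : ∀ᵐ ω ∂P, (∀ n, X n ω ≠ 0) ∨ ∀ N, ∃ n ≥ N, X n ω = 0 := by
    by_cases h : P {ω | X 0 ω = 0} = 0
    · exact (RandomShift.ae_ne_zero hident h).mono fun _ => Or.inl
    · exact (RandomShift.ae_frequently_zero hmeas hindep hident h).mono fun _ => Or.inr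
  refine ⟨hbasis, ?_, ?_, ?_, ?_, fun h0 => ?_, fun h0 => ?_, ?_, ?_⟩
  · filter_upwards [hbasis, hmem, hblocks, hzero] with ω hT hw hb hz
    obtain ⟨h1, h2⟩ := RandomShift.norm_shift_eq hT hr0 hRpos hw hb
    exact ⟨h1, h2, RandomShift.spectralRadius_eq_of_spectrum_eq hRpos.le
      (RandomShift.spectrum_shift hT hr0 hw hb hz).1,
      RandomShift.numericalRadius_eq_of_numericalRange_eq hRpos
        (RandomShift.numericalRange_shift hT hr0 hRpos hw hb)⟩
  · filter_upwards [hbasis, hmem, hblocks, hzero] with ω hT hw hb hz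
    exact RandomShift.spectrum_shift hT hr0 hw hb hz
  · filter_upwards [hbasis, hmem, hblocks, hzero] with ω hT hw hb hz
    exact ⟨RandomShift.approxPointSpectrum_shift hT hr0 hw hb,
      RandomShift.essSpectrum_shift hT hr0 hw hb hz⟩
  · filter_upwards [hbasis, hmem] with ω hT hw z hz
    exact RandomShift.isFredholm_shifted_of_lt hT (fun n => (hw n).1) (mem_ball_zero_iff.1 hz)
  · filter_upwards [hbasis, RandomShift.ae_frequently_zero hmeas hindep hident h0.ne']
      with ω hT hz
    exact ⟨RandomShift.pointSpectrum_of_frequently_zero hT hz,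
      RandomShift.pointSpectrum_adjoint_of_frequently_zero hT hz,
      RandomShift.not_finiteDimensional_ker hT hz⟩
  · have hne := RandomShift.ae_ne_zero hident h0
    have hpos : ∀ᵐ ω ∂P, ∀ n, 0 < X n ω := by
      filter_upwards [hmem, hne] with ω hw hω n
      exact (hr0.trans (hw n).1).lt_of_ne (hω n).symm
    filter_upwards [hbasis, hpos, RandomShift.ae_summable_sq_prod_iff hmeas hindep hident hpos
      (hmem.mono fun ω h => (h 0).2)] with ω hT hw hsum
    have hw0 : ∀ n, X n ω ≠ 0 := fun n => (hw n).ne'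
    refine ⟨RandomShift.pointSpectrum_of_ne_zero hT hw0, ?_, fun z hz => ?_⟩
    · ext z
      rw [Set.singleton_union, Set.mem_insert_iff]
      -- The adjoint kills `e 0`, so `0` is an eigenvalue even if the geometric mean is `0`.
      by_cases hz : z = 0
      · refine iff_of_true (RandomShift.mem_pointSpectrum_iff.2
          ⟨e 0, e.orthonormal.ne_zero 0, ?_⟩) (Or.inl hz)
        rw [RandomShift.adjoint_basis_zero hT, hz, zero_smul]
      · rw [RandomShift.mem_pointSpectrum_iff_ker_ne_bot,
          RandomShift.ker_shifted_adjoint_ne_bot_iff hT hw, hsum _ (norm_pos_iff.2 hz),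
          or_iff_right hz]
        rfl
    · exact (RandomShift.finrank_ker_shifted_adjoint hT hw0
        (RandomShift.mem_pointSpectrum_iff_ker_ne_bot.1 hz)).2
  · filter_upwards [hbasis, hmem, hblocks] with ω hT hw hb
    exact RandomShift.numericalRange_shift hT hr0 hRpos hw hb
  · filter_upwards [hbasis, hmem, hblocks] with ω hT hw hb
    exact RandomShift.essNumericalRange_shift hT hr0 hRpos hw hb
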